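/- A cell of $\mathbb{Z}^2$ is a unit square with corners in $\mathbb{Z}^2$, and a polyomino is a non-empty finite set of cells, any two of which are joined by a path of cells of the set in which consecutive cells share an edge. For a finite set $\mathcal{P}$ of cells let $V(\mathcal{P})$ be the set of corners of its cells, let $K$ be a field, $S_{\mathcal{P}}=K[x_v : v\in V(\mathcal{P})]$, and let $I_{\mathcal{P}}\subseteq S_{\mathcal{P}}$ be the ideal generated by all binomials $x_ax_b-x_cx_d$, where $a,b$ are the diagonal and $c,d$ the anti-diagonal corners of a rectangle $[a,b]$ with $a=(i,j)$, $b=(k,l)$, $i<k$, $j<l$, all of whose cells belong to $\mathcal{P}$. Put $K[\mathcal{P}]=S_{\mathcal{P}}/I_{\mathcal{P}}$ and $\mathrm{HP}_{K[\mathcal{P}]}(t)=\sum_{k\ge 0}\dim_K (K[\mathcal{P}])_k\,t^k$, with respect to the standard grading. Let $r,s\ge 2$, let $A$ be a cell, let $A_1,\dots,A_r$ be the $r$ consecutive cells to the right of $A$ in its row, and let $B_1,\dots,B_s$ be the $s$ consecutive cells above $A$ in its column. Put $[A,A_r]=\{A,A_1,\dots,A_r\}$, $[A,B_s]=\{A,B_1,\dots,B_s\}$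 and $\mathcal{L}=[A,A_r]\cup[A,B_s]$. Let $d_i$ and $a_i$ be the upper left and upper right corners of $B_i$, and let $b_j$ and $c_j$ be the upper right and lower right corners of $A_j$. Let $\mathcal{C}$ be a polyomino. A polyomino $\mathcal{P}$ is called an $(\mathcal{L},\mathcal{C})$-polyomino if $\mathcal{P}$ is the disjoint union of $\mathcal{L}$ and $\mathcal{C}$ and $V(\mathcal{L})\cap V(\mathcal{C})$ is one (and only one) of the sets $$\{a_{s-1},a_s,b_{r-1},b_r\},\quad \{a_{s-1},a_s,c_{r-1},c_r\},\quad \{d_{s-1},d_s,b_{r-1},b_r\},\quad \{d_{s-1},d_s,c_{r-1},c_r\}.$$ Put $\mathcal{P}_1=\mathcal{P}\setminus[A,A_r]$, $\mathcal{P}_2=\mathcal{P}\setminus[A,B_s]$, $\mathcal{P}_3=\mathcal{P}\setminus([A,A_r]\cup[A,B_s])=\mathcal{C}$ and $\mathcal{P}_4=\mathcal{P}\setminus\{A,A_1,B_1\}$. Theorem. Let $\mathcal{P}$ be an $(\mathcal{L},\mathcal{C})$-polyomino such that $I_{\mathcal{P}}$ is prime. Then $$\mathrm{HP}_{K[\mathcal{P}]}(t)=\frac{1}{1-t}\,\mathrm{HP}_{K[\mathcal{P}_4]}(t)+\frac{t}{1-t}\left[\frac{\mathrm{HP}_{K[\mathcal{P}_1]}(t)}{(1-t)^{r-2}}+\frac{\mathrm{HP}_{K[\mathcal{P}_2]}(t)}{(1-t)^{s-2}}+\frac{\mathrm{HP}_{K[\mathcal{P}_3]}(t)}{(1-t)^{r+s-3}}\right].$$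 -/

import Mathlib

namespace Polyomino

/-- A cell `[v, v + (1,1)]` of `ℤ²` is encoded by its lower left corner `v`. -/
abbrev Cell := ℤ × ℤ

/-! The four corners of a cell. -/

def lowerLeft (C : Cell) : ℤ × ℤ := C

def lowerRight (C : Cell) : ℤ × ℤ := C + (1, 0)

def upperLeft (C : Cell) : ℤ × ℤ := C + (0, 1)

def upperRight (C : Cell) : ℤ × ℤ := C + (1, 1)

/-- The vertex set `V(C)` of a cell. -/
def cellVertices (C : Cell) : Finset (ℤ × ℤ) :=
  {lowerLeft C, lowerRight C, upperLeft C, upperRight C}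

/-- The edge set `E(C)` of a cell. -/
def cellEdges (C : Cell) : Finset (Finset (ℤ × ℤ)) :=
  {{lowerLeft C, upperLeft C}, {upperLeft C, upperRight C},
    {upperRight C, lowerRight C}, {lowerLeft C, lowerRight C}}

/-- The graph on all cells of `ℤ²` in which two distinct cells are adjacent when they meet in a
common edge. Its walks are the walks of cells. -/
def cellGraph : SimpleGraph Cell where
  Adj C D := C ≠ D ∧ cellVertices C ∩ cellVertices D ∈ cellEdges C ∧
    cellVertices C ∩ cellVertices D ∈ cellEdges D
  symm := ⟨fun C D h => ⟨h.1.symm, by rw [Finset.inter_comm]; exact h.2.2,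
    by rw [Finset.inter_comm]; exact h.2.1⟩⟩
  loopless := ⟨fun _ h => h.1 rfl⟩

/-- A polyomino is a non-empty finite collection of cells, any two of which are connected by a path
of cells of the collection (`SimpleGraph.Connected` includes non-emptiness). -/
def IsPolyomino (P : Finset Cell) : Prop :=
  (cellGraph.induce (P : Set Cell)).Connected

/-- The vertex set `V(P)` of a collection of cells. -/
def vertexSet (P : Finset Cell) : Finset (ℤ × ℤ) :=
  P.biUnion cellVertices

/-- `[a, b]` is an inner interval of `P`: it is a proper interval and all its cells belong to
`P`. -/
def IsInnerInterval (P : Finset Cell) (a b : ℤ × ℤ) : Prop :=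
  a.1 < b.1 ∧ a.2 < b.2 ∧
    ∀ C : Cell, a.1 ≤ C.1 → C.1 < b.1 → a.2 ≤ C.2 → C.2 < b.2 → C ∈ P

/-- All four corners of an inner interval of `P` are vertices of `P`. -/
theorem IsInnerInterval.corners_mem {P : Finset Cell} {a b : ℤ × ℤ} (h : IsInnerInterval P a b) :
    a ∈ vertexSet P ∧ b ∈ vertexSet P ∧ (a.1, b.2) ∈ vertexSet P ∧ (b.1, a.2) ∈ vertexSet P := by
  obtain ⟨h1, h2, h3⟩ := h
  simp only [vertexSet, Finset.mem_biUnion, cellVertices, lowerLeft, lowerRight, upperLeft,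
    upperRight, Finset.mem_insert, Finset.mem_singleton, Prod.ext_iff, Prod.fst_add, Prod.snd_add]
  exact ⟨⟨(a.1, a.2), h3 _ le_rfl h1 le_rfl h2, by simp⟩,
    ⟨(b.1 - 1, b.2 - 1), h3 _ (by simp; lia) (by simp) (by simp; lia) (by simp), by simp⟩,
    ⟨(a.1, b.2 - 1), h3 _ (by simp) (by simpa using h1) (by simp; lia) (by simp), by simp⟩,
    ⟨(b.1 - 1, a.2), h3 _ (by simp; lia) (by simp) (by simp) (by simpa using h2), by simp⟩⟩

/-- The polyomino ideal `I_P` in `S_P = K[x_v | v ∈ V(P)]`, generated by the inner 2-minors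
`x_a x_b - x_c x_d`, where `a, b` are the diagonal corners and `c, d` the anti-diagonal corners of
an inner interval of `P`. -/
noncomputable def polyominoIdeal (K : Type*) [Field K] (P : Finset Cell) :
    Ideal (MvPolynomial (vertexSet P) K) :=
  Ideal.span {f | ∃ a b c d : vertexSet P, IsInnerInterval P a b ∧
    (c : ℤ × ℤ) = ((a : ℤ × ℤ).1, (b : ℤ × ℤ).2) ∧ (d : ℤ × ℤ) = ((b : ℤ × ℤ).1, (a : ℤ × ℤ).2) ∧
    f = MvPolynomial.X a * MvPolynomial.X b - MvPolynomial.X c * MvPolynomial.X d}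

/-- The Hilbert function `k ↦ dim_K (R/I)_k` of `R/I`, for a (homogeneous) ideal `I` of a standard
graded polynomial ring `R` in finitely many variables; `(R/I)_k` is the image of `R_k` in `R/I`. -/
noncomputable def hilbertFunction {K σ : Type*} [Field K] [Finite σ]
    (I : Ideal (MvPolynomial σ K)) (k : ℕ) : ℕ :=
  Module.finrank K
    ((MvPolynomial.homogeneousSubmodule σ K k).map (Ideal.Quotient.mkₐ K I).toLinearMap)

/-- The Hilbert-Poincaré series `HP_{K[P]}(t)` of the coordinate ring `K[P] = S_P / I_P`. -/
noncomputable def HP (K : Type*) [Field K] (P : Finset Cell) : PowerSeries ℚ :=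
  PowerSeries.mk fun k => (hilbertFunction (polyominoIdeal K P) k : ℚ)

/-- The cell `A_j`, lying `j` steps to the right of `A`. -/
def rightCell (A : Cell) (j : ℕ) : Cell := A + ((j : ℤ), 0)

/-- The cell `B_i`, lying `i` steps above `A`. -/
def upCell (A : Cell) (i : ℕ) : Cell := A + (0, (i : ℤ))

/-- The cell interval `[A, B]`: all cells whose lower left corner lies in the integer interval
between those of `A` and `B` (in the product order of `ℤ²`). -/
noncomputable def cellInterval (A B : Cell) : Finset Cell := Finset.Icc A B

/-- The polyomino `L = [A, A_r] ∪ [A, B_s]`. -/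
noncomputable def lShape (A : Cell) (r s : ℕ) : Finset Cell :=
  cellInterval A (rightCell A r) ∪ cellInterval A (upCell A s)

/-- The four admissible values of `V(L) ∩ V(C)`. Here the upper right and upper left corners of
`B_i` are the points `a_i` and `d_i`, and the upper right and lower right corners of `A_j` are the
points `b_j` and `c_j`. -/
def junction (A : Cell) (r s : ℕ) : Fin 4 → Finset (ℤ × ℤ) :=
  ![{upperRight (upCell A (s - 1)), upperRight (upCell A s),
      upperRight (rightCell A (r - 1)), upperRight (rightCell A r)},
    {upperRight (upCell A (s - 1)), upperRight (upCell A s),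
      lowerRight (rightCell A (r - 1)), lowerRight (rightCell A r)},
    {upperLeft (upCell A (s - 1)), upperLeft (upCell A s),
      upperRight (rightCell A (r - 1)), upperRight (rightCell A r)},
    {upperLeft (upCell A (s - 1)), upperLeft (upCell A s),
      lowerRight (rightCell A (r - 1)), lowerRight (rightCell A r)}]

/-- `P` is an `(L, C)`-polyomino, where `L` is the L-shape with corner cell `A` and arms
`A_1, …, A_r` and `B_1, …, B_s`. -/
structure IsLCPolyomino (A : Cell) (r s : ℕ) (C P : Finset Cell) : Prop where
  two_le_r : 2 ≤ r
  two_le_s : 2 ≤ s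
  isPolyomino_C : IsPolyomino C
  isPolyomino : IsPolyomino P
  disjoint : Disjoint (lShape A r s) C
  eq_union : P = lShape A r s ∪ C
  junction_eq : ∃! i : Fin 4, vertexSet (lShape A r s) ∩ vertexSet C = junction A r s i

/-- `P₁ = P \ [A, A_r]`. -/
noncomputable def P₁ (A : Cell) (r : ℕ) (P : Finset Cell) : Finset Cell :=
  P \ cellInterval A (rightCell A r)

/-- `P₂ = P \ [A, B_s]`. -/
noncomputable def P₂ (A : Cell) (s : ℕ) (P : Finset Cell) : Finset Cell :=
  P \ cellInterval A (upCell A s)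

/-- `P₃ = P \ ([A, A_r] ∪ [A, B_s])`. -/
noncomputable def P₃ (A : Cell) (r s : ℕ) (P : Finset Cell) : Finset Cell :=
  P \ (cellInterval A (rightCell A r) ∪ cellInterval A (upCell A s))

/-- `P₄ = P \ {A, A_1, B_1}`. -/
def P₄ (A : Cell) (P : Finset Cell) : Finset Cell :=
  P \ {A, rightCell A 1, upCell A 1}

end Polyomino

namespace Polyomino

open MvPolynomial

/-! ### Hilbert functions of graded quotients and colon ideals by a variable -/

section Hilbert

variable {K σ τ : Type*} [Field K]

/-! Multiplication by a variable gives `HS(I) = HS(I + (x)) + t * HS(I : x)` for a homogeneous ideal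
`I` (`hilbertSeries_eq_add_X_mul`). The proof adds the four corners of the cell `A` to `I_P` one at
a time and recognises every colon ideal.

Each arm has an outer side, the one without junction vertices. Let `v` be the corner of `A` on both
outer sides, `y₁` the other one on the outer side of the vertical arm, `y₂` the other one on the
outer side of the horizontal arm, and `y₃` the last corner. As `I_P` is prime and does not contain
`v`, adding `v` costs a factor `1/(1-t)`. Adding `y₁`, `y₂`, `y₃` in turn gives colon ideals
generated over `I_P` by the outer row, by the outer column, and by both. After all four corners the
quotient is `K[P₄]`.

One inclusion for each colon ideal comes from the 2-minors of an arm: `y₁ * z`, with `z` on the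
outer row, is congruent to a multiple of `v`. For the other, call a set of variables a face if it
meets one monomial of each generating binomial exactly when it meets the other (`IsFace`). Killing a
face maps `I_P` to itself, so `I_P` plus a face is a preimage of `I_P`, hence prime. The outer sides
and the corner cell are faces.

The quotients are then identified. Killing the outer row removes all minors of the horizontal arm
and leaves `r - 2` free variables between `A` and the junction; the two surviving corners of `A`
serve as the lower end of the vertical arm of `P₁`. The outer column gives `P₂` symmetrically.
Killing both leaves `K[C]` with `(r - 2) + (s - 2) + 1` free variables. All of this rests on a
classification of the inner intervals of `P` (`Attached.interval_cases`). -/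

theorem finrank_range_eq_of_ker_eq {V W W' : Type*} [AddCommGroup V] [Module K V]
    [FiniteDimensional K V] [AddCommGroup W] [Module K W] [AddCommGroup W'] [Module K W']
    (f : V →ₗ[K] W) (g : V →ₗ[K] W') (h : LinearMap.ker f = LinearMap.ker g) :
    Module.finrank K (LinearMap.range f) = Module.finrank K (LinearMap.range g) := by
  have hf := f.finrank_range_add_finrank_ker
  have hg := g.finrank_range_add_finrank_ker
  rw [h] at hf
  omega

theorem finrank_map_add_finrank_inf_ker {V W : Type*} [AddCommGroup V] [Module K V]
    [AddCommGroup W] [Module K W] (f : V →ₗ[K] W) (U : Submodule K V) [FiniteDimensional K U] :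
    Module.finrank K (U.map f) + Module.finrank K (U ⊓ LinearMap.ker f : Submodule K V) =
      Module.finrank K U := by
  have h := (f.domRestrict U).finrank_range_add_finrank_ker
  rw [LinearMap.range_domRestrict, LinearMap.ker_domRestrict] at h
  rw [← h, ← Submodule.map_comap_subtype, Submodule.finrank_map_subtype_eq]

instance finiteDimensional_homogeneousSubmodule [Finite σ] (k : ℕ) :
    FiniteDimensional K (homogeneousSubmodule σ K k) :=
  Module.Finite.iff_fg.mpr (homogeneousSubmodule_fg σ K k)

/-- The ideal contains the homogeneous components of its elements. -/
def IsHomogeneousIdeal (I : Ideal (MvPolynomial σ K)) : Prop :=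
  ∀ f ∈ I, ∀ k, homogeneousComponent k f ∈ I

theorem isHomogeneousIdeal_span {s : Set (MvPolynomial σ K)}
    (h : ∀ f ∈ s, ∃ n, f.IsHomogeneous n) : IsHomogeneousIdeal (Ideal.span s) := by
  let _ : GradedAlgebra (homogeneousSubmodule σ K) := MvPolynomial.gradedAlgebra
  have H : (Ideal.span s).IsHomogeneous (homogeneousSubmodule σ K) :=
    Ideal.homogeneous_span _ _ h
  exact fun f hf k => homogeneousComponent_mem_of_mem H hf k

theorem homogeneousComponent_succ_X_mul (x : σ) (f : MvPolynomial σ K) (k : ℕ) :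
    homogeneousComponent (k + 1) (X x * f) = X x * homogeneousComponent k f := by
  classical
  ext d
  simp only [coeff_homogeneousComponent, coeff_X_mul']
  by_cases hx : x ∈ d.support
  · have h1 : Finsupp.single x 1 ≤ d := by
      rw [Finsupp.single_le_iff]
      exact Nat.one_le_iff_ne_zero.mpr (Finsupp.mem_support_iff.mp hx)
    have h2 : d.degree = (d - Finsupp.single x 1).degree + 1 := by
      conv_lhs => rw [← tsub_add_cancel_of_le h1]
      simp
    simp [hx, h2]
  · simp [hx]

theorem homogeneousComponent_zero_X_mul (x : σ) (f : MvPolynomial σ K) :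
    homogeneousComponent 0 (X x * f) = 0 := by
  classical
  simp [homogeneousComponent_zero, coeff_X_mul']

theorem map_factor_homogeneousSubmodule {I J : Ideal (MvPolynomial σ K)} (h : I ≤ J) (k : ℕ) :
    ((homogeneousSubmodule σ K k).map (Ideal.Quotient.mkₐ K I).toLinearMap).map
      (Ideal.Quotient.factorₐ K h).toLinearMap =
    (homogeneousSubmodule σ K k).map (Ideal.Quotient.mkₐ K J).toLinearMap := by
  rw [← Submodule.map_comp]
  rfl

variable [Finite σ]

theorem hilbertFunction_eq_finrank_range (I : Ideal (MvPolynomial σ K)) (k : ℕ) :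
    hilbertFunction I k = Module.finrank K (LinearMap.range
      ((Ideal.Quotient.mkₐ K I).toLinearMap.domRestrict (homogeneousSubmodule σ K k))) := by
  rw [hilbertFunction, LinearMap.range_domRestrict]

/-- The Hilbert series of the quotient by a homogeneous ideal. -/
noncomputable def hilbertSeries (I : Ideal (MvPolynomial σ K)) : PowerSeries ℚ :=
  PowerSeries.mk fun k => (hilbertFunction I k : ℚ)

theorem hilbertFunction_zero_add_X {I J : Ideal (MvPolynomial σ K)} (hI : IsHomogeneousIdeal I)
    (x : σ) (hJ : J = I ⊔ Ideal.span {X x}) :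
    hilbertFunction I 0 = hilbertFunction J 0 := by
  rw [hilbertFunction_eq_finrank_range, hilbertFunction_eq_finrank_range]
  apply finrank_range_eq_of_ker_eq
  ext ⟨f, hf⟩
  simp only [LinearMap.mem_ker, LinearMap.domRestrict_apply, AlgHom.toLinearMap_apply,
    Ideal.Quotient.mkₐ_eq_mk, Ideal.Quotient.eq_zero_iff_mem]
  refine ⟨fun h => hJ ▸ Ideal.mem_sup_left h, fun h => ?_⟩
  rw [hJ, Submodule.mem_sup] at h
  obtain ⟨i, hi, y, hy, rfl⟩ := h
  obtain ⟨g, rfl⟩ := Ideal.mem_span_singleton'.mp hy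
  have h0 := homogeneousComponent_eq_self hf
  rw [map_add, mul_comm g, homogeneousComponent_zero_X_mul, add_zero] at h0
  rw [mul_comm g, ← h0]
  exact hI _ hi 0

theorem hilbertFunction_succ_add_X {I J L : Ideal (MvPolynomial σ K)} (hI : IsHomogeneousIdeal I)
    (x : σ) (hJ : J = I ⊔ Ideal.span {X x}) (hL : ∀ f, f ∈ L ↔ X x * f ∈ I) (k : ℕ) :
    hilbertFunction I (k + 1) = hilbertFunction J (k + 1) + hilbertFunction L k := by
  have hIJ : I ≤ J := hJ ▸ le_sup_left
  have key := finrank_map_add_finrank_inf_ker (Ideal.Quotient.factorₐ K hIJ).toLinearMap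
    ((homogeneousSubmodule σ K (k + 1)).map (Ideal.Quotient.mkₐ K I).toLinearMap)
  rw [map_factor_homogeneousSubmodule] at key
  rw [hilbertFunction, hilbertFunction, ← key, hilbertFunction_eq_finrank_range]
  congr 1
  -- The kernel of `R/I → R/J` in degree `k + 1` is the image of multiplication by `x` on degree
  -- `k`. That map and the quotient map to `R/L` have the same kernel, so their ranks agree.
  rw [finrank_range_eq_of_ker_eq _ (((Ideal.Quotient.mkₐ K I).toLinearMap.comp
    (LinearMap.mulLeft K (X x))).domRestrict (homogeneousSubmodule σ K k))]
  · apply congrArg fun U : Submodule K (MvPolynomial σ K ⧸ I) => Module.finrank K U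
    rw [LinearMap.range_domRestrict]
    ext y
    simp only [Submodule.mem_inf, Submodule.mem_map, LinearMap.mem_ker, AlgHom.toLinearMap_apply,
      LinearMap.comp_apply, LinearMap.mulLeft_apply, Ideal.Quotient.mkₐ_eq_mk]
    constructor
    · rintro ⟨⟨f, hf, rfl⟩, h⟩
      change Ideal.Quotient.mk J f = 0 at h
      rw [Ideal.Quotient.eq_zero_iff_mem, hJ, Submodule.mem_sup] at h
      obtain ⟨i, hi, y, hy, rfl⟩ := h
      obtain ⟨g, rfl⟩ := Ideal.mem_span_singleton'.mp hy
      refine ⟨homogeneousComponent k g, homogeneousComponent_mem _ _, ?_⟩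
      have h0 := homogeneousComponent_eq_self hf
      rw [map_add, mul_comm g, homogeneousComponent_succ_X_mul] at h0
      rw [mul_comm g, ← h0, map_add, Ideal.Quotient.eq_zero_iff_mem.mpr (hI _ hi _), zero_add]
    · rintro ⟨f, hf, rfl⟩
      refine ⟨⟨X x * f, ?_, rfl⟩, ?_⟩
      · rw [add_comm]
        exact (isHomogeneous_X K x).mul hf
      · change Ideal.Quotient.mk J (X x * f) = 0
        rw [Ideal.Quotient.eq_zero_iff_mem, hJ]
        exact Ideal.mem_sup_right (Ideal.mul_mem_right _ _ (Ideal.mem_span_singleton_self _))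
  · ext ⟨f, hf⟩
    simp only [LinearMap.mem_ker, LinearMap.domRestrict_apply, AlgHom.toLinearMap_apply,
      LinearMap.comp_apply, LinearMap.mulLeft_apply, Ideal.Quotient.mkₐ_eq_mk,
      Ideal.Quotient.eq_zero_iff_mem, hL]

/-- The Hilbert series along multiplication by a variable: `L` is the colon ideal `I : x`. -/
theorem hilbertSeries_eq_add_X_mul {I J L : Ideal (MvPolynomial σ K)} (hI : IsHomogeneousIdeal I)
    (x : σ) (hJ : J = I ⊔ Ideal.span {X x}) (hL : ∀ f, f ∈ L ↔ X x * f ∈ I) :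
    hilbertSeries I = hilbertSeries J + PowerSeries.X * hilbertSeries L := by
  ext k
  cases k with
  | zero => simp [hilbertSeries, hilbertFunction_zero_add_X hI x hJ]
  | succ k => simp [hilbertSeries, hilbertFunction_succ_add_X hI x hJ hL,
      PowerSeries.coeff_succ_X_mul]

variable [Finite τ]

/-- The Hilbert series is unchanged under a graded surjection that identifies the quotients. -/
theorem hilbertSeries_eq_of_comap {I : Ideal (MvPolynomial σ K)} {J : Ideal (MvPolynomial τ K)}
    (φ : MvPolynomial σ K →ₐ[K] MvPolynomial τ K) (ψ : MvPolynomial τ K →ₐ[K] MvPolynomial σ K)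
    (hφ : ∀ f k, f.IsHomogeneous k → (φ f).IsHomogeneous k)
    (hψ : ∀ f k, f.IsHomogeneous k → (ψ f).IsHomogeneous k)
    (hφψ : ∀ f, φ (ψ f) = f) (hIJ : ∀ f, f ∈ I ↔ φ f ∈ J) :
    hilbertSeries I = hilbertSeries J := by
  ext k
  simp only [hilbertSeries, PowerSeries.coeff_mk, Nat.cast_inj]
  rw [hilbertFunction_eq_finrank_range, finrank_range_eq_of_ker_eq _
    (((Ideal.Quotient.mkₐ K J).toLinearMap.comp φ.toLinearMap).domRestrict
      (homogeneousSubmodule σ K k)), hilbertFunction, LinearMap.range_domRestrict]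
  · apply congrArg fun U : Submodule K (MvPolynomial τ K ⧸ J) => Module.finrank K U
    rw [Submodule.map_comp]
    congr 1
    ext f
    simp only [Submodule.mem_map, mem_homogeneousSubmodule, AlgHom.toLinearMap_apply]
    exact ⟨fun ⟨g, hg, h⟩ => h ▸ hφ _ _ hg, fun h => ⟨ψ f, hψ _ _ h, hφψ f⟩⟩
  · ext ⟨f, hf⟩
    simp [Ideal.Quotient.eq_zero_iff_mem, hIJ, LinearMap.domRestrict_apply]

end Hilbert

/-! ### Binomial ideals, faces and free variables -/

section Binomial

variable {K : Type*} [Field K] {σ : Type*}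

/-- The ideal generated by the binomials `x_a x_b - x_c x_d` with `G a b c d` and by the variables
in `Z`. -/
noncomputable def binomialIdeal (K : Type*) [Field K] {σ : Type*} (G : σ → σ → σ → σ → Prop)
    (Z : Set σ) : Ideal (MvPolynomial σ K) :=
  Ideal.span ({f | ∃ a b c d, G a b c d ∧ f = X a * X b - X c * X d} ∪ Set.image X Z)

/-- Setting the variables in `Z` to zero maps each of the binomials to a binomial or to zero. -/
def IsFace (G : σ → σ → σ → σ → Prop) (Z : Set σ) : Prop :=
  ∀ a b c d, G a b c d → ((a ∈ Z ∨ b ∈ Z) ↔ (c ∈ Z ∨ d ∈ Z))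

theorem IsFace.union {G : σ → σ → σ → σ → Prop} {Z Y : Set σ} (hZ : IsFace G Z)
    (hY : IsFace G Y) : IsFace G (Z ∪ Y) := by
  intro a b c d h
  have h1 := hZ a b c d h
  have h2 := hY a b c d h
  simp only [Set.mem_union]
  tauto

variable {G : σ → σ → σ → σ → Prop} {Z Y : Set σ}

theorem binomial_mem_binomialIdeal {a b c d : σ} (h : G a b c d) :
    (X a * X b - X c * X d : MvPolynomial σ K) ∈ binomialIdeal K G Z :=
  Ideal.subset_span (Or.inl ⟨a, b, c, d, h, rfl⟩)

theorem X_mem_binomialIdeal {z : σ} (h : z ∈ Z) :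
    (X z : MvPolynomial σ K) ∈ binomialIdeal K G Z :=
  Ideal.subset_span (Or.inr ⟨z, h, rfl⟩)

theorem binomialIdeal_mono (h : Z ⊆ Y) : binomialIdeal K G Z ≤ binomialIdeal K G Y :=
  Ideal.span_mono (Set.union_subset_union_right _ (Set.image_mono h))

theorem binomialIdeal_le_iff {I : Ideal (MvPolynomial σ K)} :
    binomialIdeal K G Z ≤ I ↔ (∀ a b c d, G a b c d → X a * X b - X c * X d ∈ I) ∧
      ∀ z ∈ Z, X z ∈ I := by
  rw [binomialIdeal, Ideal.span_le]
  constructor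
  · exact fun h => ⟨fun a b c d hG => h (Or.inl ⟨a, b, c, d, hG, rfl⟩),
      fun z hz => h (Or.inr ⟨z, hz, rfl⟩)⟩
  · rintro ⟨h1, h2⟩ f (⟨a, b, c, d, hG, rfl⟩ | ⟨z, hz, rfl⟩)
    exacts [h1 a b c d hG, h2 z hz]

theorem binomialIdeal_insert (y : σ) :
    binomialIdeal K G (insert y Z) = binomialIdeal K G Z ⊔ Ideal.span {X y} := by
  apply le_antisymm
  · rw [binomialIdeal_le_iff]
    refine ⟨fun a b c d h => Ideal.mem_sup_left (binomial_mem_binomialIdeal h), ?_⟩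
    rintro z (rfl | hz)
    · exact Ideal.mem_sup_right (Ideal.mem_span_singleton_self _)
    · exact Ideal.mem_sup_left (X_mem_binomialIdeal hz)
  · refine sup_le (binomialIdeal_mono (Set.subset_insert _ _)) ?_
    rw [Ideal.span_singleton_le_iff_mem]
    exact X_mem_binomialIdeal (Set.mem_insert _ _)

theorem isHomogeneousIdeal_binomialIdeal : IsHomogeneousIdeal (binomialIdeal K G Z) := by
  apply isHomogeneousIdeal_span
  rintro f (⟨a, b, c, d, -, rfl⟩ | ⟨z, -, rfl⟩)
  · exact ⟨2, ((isHomogeneous_X K a).mul (isHomogeneous_X K b)).sub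
      ((isHomogeneous_X K c).mul (isHomogeneous_X K d))⟩
  · exact ⟨1, isHomogeneous_X K z⟩

open Classical in
/-- The endomorphism setting the variables in `Z` to zero. -/
noncomputable def killHom (K : Type*) [Field K] (Z : Set σ) :
    MvPolynomial σ K →ₐ[K] MvPolynomial σ K :=
  aeval fun z => if z ∈ Z then 0 else X z

theorem killHom_X_of_mem {z : σ} (h : z ∈ Z) : killHom K Z (X z) = 0 := by
  simp [killHom, h]

theorem killHom_X_of_notMem {z : σ} (h : z ∉ Z) : killHom K Z (X z) = X z := by
  simp [killHom, h]

theorem sub_algHom_mem {τ : Type*} {I : Ideal (MvPolynomial τ K)}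
    (φ ψ : MvPolynomial σ K →ₐ[K] MvPolynomial τ K) (h : ∀ z, φ (X z) - ψ (X z) ∈ I)
    (f : MvPolynomial σ K) : φ f - ψ f ∈ I := by
  rw [← Ideal.Quotient.eq]
  change ((Ideal.Quotient.mkₐ K I).comp φ) f = ((Ideal.Quotient.mkₐ K I).comp ψ) f
  congr 1
  ext z
  exact Ideal.Quotient.eq.mpr (h z)

/-- The face condition makes `killHom` send each binomial to itself or to `0`, and `f - killHom K Z
f` always lies in the ideal of the variables in `Z`. -/
theorem IsFace.mem_binomialIdeal_iff (hZ : IsFace G Z) (f : MvPolynomial σ K) :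
    f ∈ binomialIdeal K G Z ↔ killHom K Z f ∈ binomialIdeal K G ∅ := by
  constructor
  · suffices binomialIdeal K G Z ≤ (binomialIdeal K G ∅).comap (killHom K Z) from fun h => this h
    rw [binomialIdeal_le_iff]
    refine ⟨fun a b c d h => ?_, fun z hz => ?_⟩
    · have := hZ a b c d h
      rw [Ideal.mem_comap, map_sub, map_mul, map_mul]
      by_cases hab : a ∈ Z ∨ b ∈ Z
      · have h1 : killHom K Z (X a) * killHom K Z (X b) = 0 := by
          rcases hab with h | h <;> simp [killHom_X_of_mem h]
        have h2 : killHom K Z (X c) * killHom K Z (X d) = 0 := by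
          rcases this.mp hab with h | h <;> simp [killHom_X_of_mem h]
        rw [h1, h2, sub_zero]
        exact Ideal.zero_mem _
      · have hcd : ¬ (c ∈ Z ∨ d ∈ Z) := fun h => hab (this.mpr h)
        push Not at hab hcd
        rw [killHom_X_of_notMem hab.1, killHom_X_of_notMem hab.2, killHom_X_of_notMem hcd.1,
          killHom_X_of_notMem hcd.2]
        exact binomial_mem_binomialIdeal h
    · rw [Ideal.mem_comap, killHom_X_of_mem hz]
      exact Ideal.zero_mem _
  · intro h
    have h1 := sub_algHom_mem (I := binomialIdeal K G Z) (AlgHom.id K _) (killHom K Z)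
      (fun z => by
        by_cases hz : z ∈ Z
        · simpa [killHom_X_of_mem hz] using X_mem_binomialIdeal hz
        · simp [killHom_X_of_notMem hz]) f
    simpa using Ideal.add_mem _ h1 (binomialIdeal_mono (Set.empty_subset Z) h)

/-- The ideal is the preimage of a prime under an algebra endomorphism, so primality for the empty
set passes to every face. -/
theorem IsFace.isPrime (hZ : IsFace G Z) (h : (binomialIdeal K G ∅).IsPrime) :
    (binomialIdeal K G Z).IsPrime := by
  have : binomialIdeal K G Z = (binomialIdeal K G ∅).comap (killHom K Z) :=
    Ideal.ext hZ.mem_binomialIdeal_iff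
  rw [this]
  exact Ideal.IsPrime.comap _

/-- All binomials `x_a x_b - x_c x_d` are squarefree. -/
def IsSquarefree (G : σ → σ → σ → σ → Prop) : Prop :=
  ∀ a b c d, G a b c d → a ≠ b ∧ c ≠ d

/-- Evaluate at the point with coordinate `1` at `y` and `0` elsewhere: squarefree quadratic
monomials and the variables in `Z` vanish there, but `X y` does not. -/
theorem IsSquarefree.X_notMem (hG : IsSquarefree G) {y : σ} (hy : y ∉ Z) :
    X y ∉ binomialIdeal K G Z := by
  classical
  let e : MvPolynomial σ K →ₐ[K] K := aeval (Pi.single y (1 : K))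
  have he : binomialIdeal K G Z ≤ RingHom.ker e := by
    rw [binomialIdeal_le_iff]
    refine ⟨fun a b c d h => ?_, fun z hz => ?_⟩
    · obtain ⟨h1, h2⟩ := hG a b c d h
      have h3 : ∀ u v : σ, u ≠ v → (Pi.single y (1 : K) : σ → K) u *
          (Pi.single y (1 : K) : σ → K) v = 0 := by
        intro u v huv
        by_cases hu : u = y
        · rw [Pi.single_eq_of_ne (M := fun _ => K) (i := y) (i' := v)
            (fun h => huv (hu.trans h.symm)), mul_zero]
        · rw [Pi.single_eq_of_ne (M := fun _ => K) hu, zero_mul]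
      simp [RingHom.mem_ker, e, h3 a b h1, h3 c d h2]
    · rw [RingHom.mem_ker]
      simp only [e, aeval_X]
      exact Pi.single_eq_of_ne (M := fun _ => K) (fun h : z = y => hy (h ▸ hz)) _
  intro h
  have := he h
  simp [RingHom.mem_ker, e] at this

variable [Finite σ]

/-- Adding a variable to a face ideal, with the colon ideal a face ideal as well. -/
theorem hilbertSeries_binomialIdeal_insert (hG : IsSquarefree G)
    (hI : (binomialIdeal K G ∅).IsPrime) {y : σ} (hZ : IsFace G Z) (hYZ : Y ⊆ Z) (hy : y ∉ Z)
    (hyz : ∀ z ∈ Z, X y * X z ∈ binomialIdeal K G Y) :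
    hilbertSeries (binomialIdeal K G Y) = hilbertSeries (binomialIdeal K G (insert y Y)) +
      PowerSeries.X * hilbertSeries (binomialIdeal K G Z) := by
  refine hilbertSeries_eq_add_X_mul isHomogeneousIdeal_binomialIdeal y (binomialIdeal_insert y) ?_
  intro f
  constructor
  · suffices binomialIdeal K G Z ≤ Submodule.comap
      (LinearMap.mulLeft (MvPolynomial σ K) (X y)) (binomialIdeal K G Y) from
      fun h => this h
    rw [binomialIdeal_le_iff]
    refine ⟨fun a b c d h => ?_, hyz⟩
    exact Ideal.mul_mem_left _ _ (binomial_mem_binomialIdeal h)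
  -- The colon of the smaller ideal by `y` lies in that of the face ideal, which is prime and does
  -- not contain `X y`.
  · intro h
    exact ((hZ.isPrime hI).mem_or_mem (binomialIdeal_mono hYZ h)).resolve_left (hG.X_notMem hy)

theorem inv_one_sub_X_mul : (1 - PowerSeries.X : PowerSeries ℚ)⁻¹ * (1 - PowerSeries.X) = 1 := by
  refine PowerSeries.inv_mul_cancel _ ?_
  rw [map_sub, map_one, PowerSeries.constantCoeff_X, sub_zero]
  exact one_ne_zero

theorem eq_inv_mul_of_eq_add {R : Type*} [CommRing R] {a b x u : R} (h : a = b + x * a)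
    (hu : u * (1 - x) = 1) : a = u * b := by
  linear_combination u * h - a * hu

theorem IsFace.hilbertSeries_insert (hG : IsSquarefree G) (hI : (binomialIdeal K G ∅).IsPrime)
    {y : σ} (hZ : IsFace G Z) (hy : y ∉ Z) :
    hilbertSeries (binomialIdeal K G Z) = (1 - PowerSeries.X)⁻¹ *
      hilbertSeries (binomialIdeal K G (insert y Z)) := by
  have h := hilbertSeries_binomialIdeal_insert hG hI hZ subset_rfl hy
    fun z hz => Ideal.mul_mem_left _ _ (X_mem_binomialIdeal hz)
  exact eq_inv_mul_of_eq_add h inv_one_sub_X_mul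

/-- Variables that occur in no binomial outside the face contribute a factor `1 / (1 - t)` each. -/
theorem IsFace.hilbertSeries_union (hG : IsSquarefree G) (hI : (binomialIdeal K G ∅).IsPrime)
    (F : Finset σ) (hZ : IsFace G Z) (hF : ∀ z ∈ F, z ∉ Z)
    (hfree : ∀ a b c d, G a b c d → a ∉ Z → b ∉ Z → c ∉ Z → d ∉ Z →
      a ∉ F ∧ b ∉ F ∧ c ∉ F ∧ d ∉ F) :
    hilbertSeries (binomialIdeal K G Z) = ((1 - PowerSeries.X)⁻¹) ^ F.card *
      hilbertSeries (binomialIdeal K G (Z ∪ F)) := by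
  classical
  induction F using Finset.induction_on with
  | empty => simp
  | insert y F hyF ih =>
    -- A binomial that meets `Z` does so in both monomials, and one that avoids `Z` avoids `F` too.
    have hZF : IsFace G (Z ∪ F) := by
      intro a b c d h
      have h1 := hZ a b c d h
      have h2 := hfree a b c d h
      simp only [Finset.mem_insert, Set.mem_union, Finset.mem_coe] at h2 ⊢
      grind
    have hy : y ∉ Z ∪ F := by
      simpa [hyF] using hF y (Finset.mem_insert_self _ _)
    rw [ih (fun z hz => hF z (Finset.mem_insert_of_mem hz)) (fun a b c d h ha hb hc hd => by
        have h2 := hfree a b c d h ha hb hc hd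
        simp only [Finset.mem_insert] at h2
        grind), hZF.hilbertSeries_insert hG hI hy,
      Finset.card_insert_of_notMem hyF, pow_succ, mul_assoc, Finset.coe_insert, Set.union_insert]

/-- Comparison of a face ideal with the binomial ideal on the remaining variables. -/
theorem hilbertSeries_binomialIdeal_eq {τ : Type*} [Finite τ] {H : τ → τ → τ → τ → Prop}
    (hZ : IsFace G Z) (e : τ → σ) (he : Function.Injective e) (hrange : ∀ z, z ∉ Z ↔ ∃ t, e t = z)
    (hGH : ∀ a b c d, G (e a) (e b) (e c) (e d) ↔ H a b c d) :
    hilbertSeries (binomialIdeal K G Z) = hilbertSeries (binomialIdeal K H ∅) := by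
  classical
  have heZ : ∀ t, e t ∉ Z := fun t => (hrange _).mpr ⟨t, rfl⟩
  let φ : MvPolynomial σ K →ₐ[K] MvPolynomial τ K :=
    aeval fun z => if h : ∃ t, e t = z then X h.choose else 0
  have hφe : ∀ t, φ (X (e t)) = X t := by
    intro t
    have h : ∃ t', e t' = e t := ⟨t, rfl⟩
    simp only [φ, aeval_X, dif_pos h]
    rw [he h.choose_spec]
  have hφZ : ∀ z ∈ Z, φ (X z) = 0 := by
    intro z hz
    have h : ¬ ∃ t, e t = z := fun h => (hrange z).mpr h hz
    simp only [φ, aeval_X, dif_neg h]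
  have hφψ : ∀ f, φ (rename e f) = f := by
    intro f
    change (φ.comp (rename e)) f = AlgHom.id K _ f
    congr 1
    ext t : 1
    simp [hφe]
  refine hilbertSeries_eq_of_comap φ (rename e) ?_ (fun f k hf => hf.rename_isHomogeneous) hφψ ?_
  · intro f k hf
    have := hf.aeval (n := 1)
      (fun z => if h : ∃ t, e t = z then (X h.choose : MvPolynomial τ K) else 0)
      (fun z => by
        split_ifs
        · exact isHomogeneous_X _ _
        · exact isHomogeneous_zero _ _ _)
    rwa [one_mul] at this
  · intro f
    constructor
    · suffices binomialIdeal K G Z ≤ (binomialIdeal K H ∅).comap φ from fun h => this h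
      rw [binomialIdeal_le_iff]
      refine ⟨fun a b c d h => ?_, fun z hz => ?_⟩
      · have := hZ a b c d h
        rw [Ideal.mem_comap, map_sub, map_mul, map_mul]
        by_cases hab : a ∈ Z ∨ b ∈ Z
        · have h1 : φ (X a) * φ (X b) = 0 := by
            rcases hab with h | h <;> simp [hφZ _ h]
          have h2 : φ (X c) * φ (X d) = 0 := by
            rcases this.mp hab with h | h <;> simp [hφZ _ h]
          rw [h1, h2, sub_zero]
          exact Ideal.zero_mem _
        · have hcd : ¬ (c ∈ Z ∨ d ∈ Z) := fun h => hab (this.mpr h)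
          push Not at hab hcd
          obtain ⟨a, rfl⟩ := (hrange a).mp hab.1
          obtain ⟨b, rfl⟩ := (hrange b).mp hab.2
          obtain ⟨c, rfl⟩ := (hrange c).mp hcd.1
          obtain ⟨d, rfl⟩ := (hrange d).mp hcd.2
          simp only [hφe]
          exact binomial_mem_binomialIdeal ((hGH a b c d).mp h)
      · rw [Ideal.mem_comap, hφZ z hz]
        exact Ideal.zero_mem _
    · intro h
      have h1 := sub_algHom_mem (I := binomialIdeal K G Z) (AlgHom.id K _) ((rename e).comp φ)
        (fun z => by
          by_cases hz : z ∈ Z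
          · simpa [hφZ z hz] using X_mem_binomialIdeal hz
          · obtain ⟨t, rfl⟩ := (hrange z).mp hz
            simp [hφe]) f
      have h2 : binomialIdeal K H ∅ ≤ (binomialIdeal K G Z).comap (rename e) := by
        rw [binomialIdeal_le_iff]
        refine ⟨fun a b c d h => ?_, fun z hz => hz.elim⟩
        simpa using binomial_mem_binomialIdeal ((hGH a b c d).mpr h)
      simpa using Ideal.add_mem _ h1 (h2 h)

end Binomial

/-! ### Classification of the inner intervals of `L ∪ C` -/

section Combinatorics

/-- `(u, v)` is a cell of the L-shape with corner cell `(p, q)`. -/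
def ArmCell (p q r s u v : ℤ) : Prop :=
  (v = q ∧ p ≤ u ∧ u ≤ p + r) ∨ (u = p ∧ q ≤ v ∧ v ≤ q + s)

/-- `(x, y)` is a vertex of the L-shape with corner cell `(p, q)`. -/
def ArmVertex (p q r s x y : ℤ) : Prop :=
  (q ≤ y ∧ y ≤ q + 1 ∧ p ≤ x ∧ x ≤ p + r + 1) ∨ (p ≤ x ∧ x ≤ p + 1 ∧ q ≤ y ∧ y ≤ q + s + 1)

/-- `(x, y)` is one of the four junction vertices; `m` and `n` tell on which side of the vertical
and of the horizontal arm they lie. -/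
def JunctionVertex (p q r s m n x y : ℤ) : Prop :=
  (x = p + m ∧ (y = q + s ∨ y = q + s + 1)) ∨ (y = q + n ∧ (x = p + r ∨ x = p + r + 1))

/-- `(x, y)` is a corner of a cell satisfying `c`. -/
def CornerOf (c : ℤ → ℤ → Prop) (x y : ℤ) : Prop :=
  c x y ∨ c (x - 1) y ∨ c x (y - 1) ∨ c (x - 1) (y - 1)

/-- The collection `c` of cells meets the L-shape exactly in the junction vertices. -/
structure Attached (p q r s m n : ℤ) (c : ℤ → ℤ → Prop) : Prop where
  two_le_r : 2 ≤ r
  two_le_s : 2 ≤ s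
  m_eq : m = 0 ∨ m = 1
  n_eq : n = 0 ∨ n = 1
  corner_iff : ∀ x y, ArmVertex p q r s x y →
    (CornerOf c x y ↔ JunctionVertex p q r s m n x y)

theorem Attached.swap {p q r s m n : ℤ} {c : ℤ → ℤ → Prop} (h : Attached p q r s m n c) :
    Attached q p s r n m fun u v => c v u := by
  refine ⟨h.two_le_s, h.two_le_r, h.n_eq, h.m_eq, fun x y hxy => ?_⟩
  have := h.corner_iff y x (by unfold ArmVertex at *; tauto)
  unfold JunctionVertex CornerOf at *
  tauto

/-- All cells of the interval `[(a₁, a₂), (b₁, b₂)]` satisfy `c`. -/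
def CellsIn (c : ℤ → ℤ → Prop) (a₁ a₂ b₁ b₂ : ℤ) : Prop :=
  ∀ u v, a₁ ≤ u → u < b₁ → a₂ ≤ v → v < b₂ → c u v

/-- A corner `(x, y)` of an interval of `c` that lies on the L-shape is a junction vertex. -/
def MeetsOnlyJunction (p q r s m n x y : ℤ) : Prop :=
  ArmVertex p q r s x y → JunctionVertex p q r s m n x y

variable {p q r s m n : ℤ} {c : ℤ → ℤ → Prop}

theorem Attached.corners_of_cell (h : Attached p q r s m n c) {u v : ℤ} (hc : c u v) :
    MeetsOnlyJunction p q r s m n u v ∧ MeetsOnlyJunction p q r s m n (u + 1) v ∧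
    MeetsOnlyJunction p q r s m n u (v + 1) ∧ MeetsOnlyJunction p q r s m n (u + 1) (v + 1) := by
  refine ⟨fun hv => (h.corner_iff _ _ hv).mp ?_, fun hv => (h.corner_iff _ _ hv).mp ?_,
    fun hv => (h.corner_iff _ _ hv).mp ?_, fun hv => (h.corner_iff _ _ hv).mp ?_⟩ <;>
  simp [CornerOf, hc]

/-- All corners of an arm cell are vertices of the L-shape, but junction vertices occupy only one
side of each arm, so they cannot include all four. -/
theorem Attached.not_armCell (h : Attached p q r s m n c) {u v : ℤ} (hc : c u v) :
    ¬ ArmCell p q r s u v := by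
  have h1 := h.corners_of_cell hc
  obtain ⟨hr, hs, hm, hn, -⟩ := h
  unfold MeetsOnlyJunction ArmVertex JunctionVertex at h1
  unfold ArmCell
  omega

/-- The interval is vertical, extending the last cell of the horizontal arm into `c`. -/
def RowExtension (p q r n : ℤ) (c : ℤ → ℤ → Prop) (a₁ a₂ b₁ b₂ : ℤ) : Prop :=
  a₁ = p + r ∧ b₁ = p + r + 1 ∧
    ((n = 1 ∧ a₂ = q ∧ q + 2 ≤ b₂ ∧ ∀ v, q + 1 ≤ v → v < b₂ → c (p + r) v) ∨
      (n = 0 ∧ a₂ < q ∧ b₂ = q + 1 ∧ ∀ v, a₂ ≤ v → v < q → c (p + r) v))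

/-- The interval is horizontal, extending the last cell of the vertical arm into `c`. -/
def ColExtension (p q s m : ℤ) (c : ℤ → ℤ → Prop) (a₁ a₂ b₁ b₂ : ℤ) : Prop :=
  a₂ = q + s ∧ b₂ = q + s + 1 ∧
    ((m = 1 ∧ a₁ = p ∧ p + 2 ≤ b₁ ∧ ∀ u, p + 1 ≤ u → u < b₁ → c u (q + s)) ∨
      (m = 0 ∧ a₁ < p ∧ b₁ = p + 1 ∧ ∀ u, a₁ ≤ u → u < p → c u (q + s)))

/-- The interval lies in the horizontal arm. -/
def RowInterval (p q r a₁ a₂ b₁ b₂ : ℤ) : Prop :=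
  a₂ = q ∧ b₂ = q + 1 ∧ p ≤ a₁ ∧ a₁ < b₁ ∧ b₁ ≤ p + r + 1

/-- The interval lies in the vertical arm. -/
def ColInterval (p q s a₁ a₂ b₁ b₂ : ℤ) : Prop :=
  a₁ = p ∧ b₁ = p + 1 ∧ q ≤ a₂ ∧ a₂ < b₂ ∧ b₂ ≤ q + s + 1

/-- A cell of `c` may touch the L-shape only at junction vertices. This stops the interval at both
ends of the horizontal arm, and lets it leave that row only through the corner cell, along the
vertical arm, or through the last cell, into `c`. -/
theorem Attached.interval_of_row_cell (h : Attached p q r s m n c) {a₁ a₂ b₁ b₂ u : ℤ}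
    (hc : CellsIn (fun u v => ArmCell p q r s u v ∨ c u v) a₁ a₂ b₁ b₂)
    (h1 : a₁ ≤ u) (h2 : u < b₁) (h3 : a₂ ≤ q) (h4 : q < b₂) (hu : p ≤ u) (hu' : u ≤ p + r) :
    RowInterval p q r a₁ a₂ b₁ b₂ ∨ ColInterval p q s a₁ a₂ b₁ b₂ ∨
      RowExtension p q r n c a₁ a₂ b₁ b₂ := by
  have key : ∀ x y, a₁ ≤ x → x < b₁ → a₂ ≤ y → y < b₂ → ArmCell p q r s x y ∨
      (c x y ∧ MeetsOnlyJunction p q r s m n x y ∧ MeetsOnlyJunction p q r s m n (x + 1) y ∧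
    MeetsOnlyJunction p q r s m n x (y + 1) ∧ MeetsOnlyJunction p q r s m n (x + 1) (y + 1)) :=
    fun x y g1 g2 g3 g4 => (hc x y g1 g2 g3 g4).imp_right fun g => ⟨g, h.corners_of_cell g⟩
  obtain ⟨hr, hs, hm, hn, -⟩ := h
  unfold MeetsOnlyJunction ArmVertex JunctionVertex ArmCell at key
  -- Otherwise the cell left of `(p, q)` would be in `c`, with the non-junction corner `(p, q)`. For
  -- `hb`, the cell past the right end has both end corners of the arm, and only one is a junction
  -- vertex.
  have ha : p ≤ a₁ := by
    by_contra hlt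
    have := key (p - 1) q
    omega
  have hb : b₁ ≤ p + r + 1 := by
    by_contra hlt
    have := key (p + r + 1) q
    omega
  by_cases hup : q + 2 ≤ b₂
  -- A cell of `c` on top of the arm needs two adjacent junction vertices below it. As `r ≥ 2`,
  -- columns `p` and `p + r` are not adjacent, so the interval has width one.
  · have hmid : ∀ x, a₁ ≤ x → x < b₁ → x = p ∨ x = p + r := by
      intro x hx hx'
      have := key x (q + 1)
      omega
    have h5 := hmid a₁
    have h6 := hmid (b₁ - 1)
    have h7 := hmid (a₁ + 1)
    have h8 : b₁ = a₁ + 1 := by omega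
    rcases h5 le_rfl (by omega) with h5 | h5
    · right; left
      have g1 := key p (q - 1)
      have g2 := key p (q + s + 1)
      unfold ColInterval
      omega
    · right; right
      have g1 := key (p + r) (q + 1)
      have g2 := key (p + r) (q - 1)
      refine ⟨h5, by omega, Or.inl ⟨by omega, by omega, hup, fun v hv hv' => ?_⟩⟩
      have := key (p + r) v
      by_contra hcon
      simp only [hcon, false_and, or_false] at this
      omega
  · by_cases hdown : a₂ < q
    · right; right
      have hmid : ∀ x, a₁ ≤ x → x < b₁ → x = p + r ∧ n = 0 := by
        intro x hx hx'
        have := key x (q - 1)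
        omega
      have h5 := hmid a₁
      have h6 := hmid (b₁ - 1)
      refine ⟨by omega, by omega, Or.inr ⟨by omega, hdown, by omega, fun v hv hv' => ?_⟩⟩
      have := key (p + r) v
      by_contra hcon
      simp only [hcon, false_and, or_false] at this
      omega
    · left
      unfold RowInterval
      omega

/-- Classification of the inner intervals of the union of the L-shape and `c`. -/
theorem Attached.interval_cases (h : Attached p q r s m n c) {a₁ a₂ b₁ b₂ : ℤ}
    (h1 : a₁ < b₁) (h2 : a₂ < b₂)
    (hc : CellsIn (fun u v => ArmCell p q r s u v ∨ c u v) a₁ a₂ b₁ b₂) :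
    (CellsIn c a₁ a₂ b₁ b₂ ∧ MeetsOnlyJunction p q r s m n a₁ a₂ ∧
      MeetsOnlyJunction p q r s m n b₁ b₂ ∧ MeetsOnlyJunction p q r s m n a₁ b₂ ∧
      MeetsOnlyJunction p q r s m n b₁ a₂) ∨
    RowInterval p q r a₁ a₂ b₁ b₂ ∨ ColInterval p q s a₁ a₂ b₁ b₂ ∨
      RowExtension p q r n c a₁ a₂ b₁ b₂ ∨ ColExtension p q s m c a₁ a₂ b₁ b₂ := by
  by_cases hrow : ∃ u, a₁ ≤ u ∧ u < b₁ ∧ a₂ ≤ q ∧ q < b₂ ∧ p ≤ u ∧ u ≤ p + r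
  · obtain ⟨u, g1, g2, g3, g4, g5, g6⟩ := hrow
    have := h.interval_of_row_cell hc g1 g2 g3 g4 g5 g6
    tauto
  by_cases hcol : ∃ v, a₂ ≤ v ∧ v < b₂ ∧ a₁ ≤ p ∧ p < b₁ ∧ q ≤ v ∧ v ≤ q + s
  -- The vertical arm is the horizontal arm of the transposed configuration.
  · obtain ⟨v, g1, g2, g3, g4, g5, g6⟩ := hcol
    have := h.swap.interval_of_row_cell (a₁ := a₂) (a₂ := a₁) (b₁ := b₂) (b₂ := b₁)
      (fun u v k1 k2 k3 k4 => (hc v u k3 k4 k1 k2).imp_left fun g => g.symm) g1 g2 g3 g4 g5 g6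
    change ColInterval p q s a₁ a₂ b₁ b₂ ∨ RowInterval p q r a₁ a₂ b₁ b₂ ∨
      ColExtension p q s m c a₁ a₂ b₁ b₂ at this
    tauto
  left
  have hcc : CellsIn c a₁ a₂ b₁ b₂ := by
    intro u v g1 g2 g3 g4
    refine (hc u v g1 g2 g3 g4).resolve_left ?_
    rintro (⟨rfl, g⟩ | ⟨rfl, g⟩)
    · exact hrow ⟨u, g1, g2, g3, g4, g⟩
    · exact hcol ⟨v, g3, g4, g1, g2, g⟩
  refine ⟨hcc, (h.corners_of_cell (hcc a₁ a₂ le_rfl h1 le_rfl h2)).1, ?_, ?_, ?_⟩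
  · simpa using (h.corners_of_cell (hcc (b₁ - 1) (b₂ - 1) (by omega) (by omega) (by omega)
      (by omega))).2.2.2
  · simpa using (h.corners_of_cell (hcc a₁ (b₂ - 1) (by omega) (by omega) (by omega)
      (by omega))).2.2.1
  · simpa using (h.corners_of_cell (hcc (b₁ - 1) a₂ (by omega) (by omega) (by omega)
      (by omega))).2.1

end Combinatorics

/-! ### Faces and surviving intervals on the L-shape -/

section Regions

/-- The side of the horizontal arm that does not contain junction vertices. -/
def OuterRow (p q r n x y : ℤ) : Prop := y = q + 1 - n ∧ p ≤ x ∧ x ≤ p + r + 1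

/-- The side of the vertical arm that does not contain junction vertices. -/
def OuterCol (p q s m x y : ℤ) : Prop := x = p + 1 - m ∧ q ≤ y ∧ y ≤ q + s + 1

/-- The corners of the cell `(p, q)`. -/
def CornerCell (p q x y : ℤ) : Prop := p ≤ x ∧ x ≤ p + 1 ∧ q ≤ y ∧ y ≤ q + 1

/-- The interior vertices of the other side of the horizontal arm. -/
def InnerRow (p q r n x y : ℤ) : Prop := y = q + n ∧ p + 2 ≤ x ∧ x ≤ p + r - 1

/-- The interior vertices of the other side of the vertical arm. -/
def InnerCol (p q s m x y : ℤ) : Prop := x = p + m ∧ q + 2 ≤ y ∧ y ≤ q + s - 1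

/-- The relabelling of the lowest vertices of the vertical arm without the cell `(p, q)`. -/
def relabel (p q n x y : ℤ) : ℤ := if y = q + 1 ∧ p ≤ x ∧ x ≤ p + 1 then q + n else y

/-- `(x, y)` is a vertex of the vertical arm without the cell `(p, q)`. -/
def ColVertex (p q s x y : ℤ) : Prop := p ≤ x ∧ x ≤ p + 1 ∧ q + 1 ≤ y ∧ y ≤ q + s + 1

/-- `(u, v)` is a cell of the vertical arm without the cell `(p, q)`. -/
def ColCell (p q s u v : ℤ) : Prop := u = p ∧ q + 1 ≤ v ∧ v ≤ q + s

variable {p q r s m n : ℤ} {c : ℤ → ℤ → Prop}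

theorem relabel_spec (p q n x y : ℤ) :
    (y = q + 1 ∧ p ≤ x ∧ x ≤ p + 1 ∧ relabel p q n x y = q + n) ∨
      ((y ≠ q + 1 ∨ x < p ∨ p + 1 < x) ∧ relabel p q n x y = y) := by
  unfold relabel
  split_ifs with h
  · omega
  · right
    refine ⟨?_, rfl⟩
    omega

theorem relabel_eq_self {p q n x y : ℤ} (h : q ≤ y → y ≤ q + 1 → x < p ∨ p + 1 < x) :
    relabel p q n x y = y := by
  have := relabel_spec p q n x y
  omega

theorem relabel_eq_self_of_relabel {p q n x y : ℤ} (hn : n = 0 ∨ n = 1)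
    (h : q ≤ relabel p q n x y → relabel p q n x y ≤ q + 1 → x < p ∨ p + 1 < x) :
    relabel p q n x y = y := by
  have := relabel_spec p q n x y
  omega

theorem Attached.meetsOnlyJunction_spec (h : Attached p q r s m n c) {x y : ℤ}
    (g : MeetsOnlyJunction p q r s m n x y) :
    ¬ OuterRow p q r n x y ∧ ¬ CornerCell p q x y ∧ ¬ InnerRow p q r n x y ∧
      (q ≤ y → y ≤ q + 1 → x < p ∨ p + 1 < x) := by
  obtain ⟨hr, hs, hm, hn, -⟩ := h
  unfold MeetsOnlyJunction ArmVertex JunctionVertex at g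
  refine ⟨?_, ?_, ?_, ?_⟩
  · unfold OuterRow
    omega
  · unfold CornerCell
    omega
  · unfold InnerRow
    omega
  · omega

/-- The outer row meets the corners of an inner interval in nothing or in one horizontal side, and a
side contains one diagonal and one anti-diagonal corner. -/
theorem Attached.outerRow_iff (h : Attached p q r s m n c) {a₁ a₂ b₁ b₂ : ℤ}
    (h1 : a₁ < b₁) (h2 : a₂ < b₂)
    (hc : CellsIn (fun u v => ArmCell p q r s u v ∨ c u v) a₁ a₂ b₁ b₂) :
    (OuterRow p q r n a₁ a₂ ∨ OuterRow p q r n b₁ b₂) ↔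
      (OuterRow p q r n a₁ b₂ ∨ OuterRow p q r n b₁ a₂) := by
  have hcases := h.interval_cases h1 h2 hc
  have hspec := fun x y => h.meetsOnlyJunction_spec (x := x) (y := y)
  obtain ⟨hr, hs, hm, hn, -⟩ := h
  rcases hcases with ⟨-, g1, g2, g3, g4⟩ | g | g | ⟨g1, g2, g⟩ | ⟨g1, g2, g⟩
  · simp [hspec _ _ g1, hspec _ _ g2, hspec _ _ g3, hspec _ _ g4]
  · unfold RowInterval at g
    unfold OuterRow
    omega
  · unfold ColInterval at g
    unfold OuterRow
    omega
  · unfold OuterRow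
    rcases g with ⟨g3, g4, g5, -⟩ | ⟨g3, g4, g5, -⟩ <;> omega
  · unfold OuterRow
    rcases g with ⟨g3, g4, g5, -⟩ | ⟨g3, g4, g5, -⟩ <;> omega

theorem Attached.outerCol_iff (h : Attached p q r s m n c) {a₁ a₂ b₁ b₂ : ℤ}
    (h1 : a₁ < b₁) (h2 : a₂ < b₂)
    (hc : CellsIn (fun u v => ArmCell p q r s u v ∨ c u v) a₁ a₂ b₁ b₂) :
    (OuterCol p q s m a₁ a₂ ∨ OuterCol p q s m b₁ b₂) ↔
      (OuterCol p q s m a₁ b₂ ∨ OuterCol p q s m b₁ a₂) := by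
  have := h.swap.outerRow_iff h2 h1
    (fun u v k1 k2 k3 k4 => (hc v u k3 k4 k1 k2).imp_left fun g => g.symm)
  change (OuterCol p q s m a₁ a₂ ∨ OuterCol p q s m b₁ b₂) ↔
      (OuterCol p q s m b₁ a₂ ∨ OuterCol p q s m a₁ b₂) at this
  rw [this, or_comm]

/-- Here too the corners hit form a union of whole sides of the interval. Since `r, s ≥ 2`, the
intervals extending into `c` stay away from the corner cell. -/
theorem Attached.cornerCell_iff (h : Attached p q r s m n c) {a₁ a₂ b₁ b₂ : ℤ}
    (h1 : a₁ < b₁) (h2 : a₂ < b₂)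
    (hc : CellsIn (fun u v => ArmCell p q r s u v ∨ c u v) a₁ a₂ b₁ b₂) :
    (CornerCell p q a₁ a₂ ∨ CornerCell p q b₁ b₂) ↔
      (CornerCell p q a₁ b₂ ∨ CornerCell p q b₁ a₂) := by
  have hcases := h.interval_cases h1 h2 hc
  have hspec := fun x y => h.meetsOnlyJunction_spec (x := x) (y := y)
  obtain ⟨hr, hs, hm, hn, -⟩ := h
  rcases hcases with ⟨-, g1, g2, g3, g4⟩ | g | g | ⟨g1, g2, g⟩ | ⟨g1, g2, g⟩
  · simp [hspec _ _ g1, hspec _ _ g2, hspec _ _ g3, hspec _ _ g4]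
  · unfold RowInterval at g
    unfold CornerCell
    omega
  · unfold ColInterval at g
    unfold CornerCell
    omega
  · unfold CornerCell
    rcases g with ⟨g3, g4, g5, -⟩ | ⟨g3, g4, g5, -⟩ <;> omega
  · unfold CornerCell
    rcases g with ⟨g3, g4, g5, -⟩ | ⟨g3, g4, g5, -⟩ <;> omega

/-- Only intervals inside the horizontal arm have corners at these vertices, and those have a
diagonal corner on the outer row. This makes the inner row variables free once the outer row is
killed. -/
theorem Attached.not_innerRow (h : Attached p q r s m n c) {a₁ a₂ b₁ b₂ : ℤ}
    (h1 : a₁ < b₁) (h2 : a₂ < b₂)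
    (hc : CellsIn (fun u v => ArmCell p q r s u v ∨ c u v) a₁ a₂ b₁ b₂)
    (ha : ¬ OuterRow p q r n a₁ a₂) (hb : ¬ OuterRow p q r n b₁ b₂) :
    ¬ InnerRow p q r n a₁ a₂ ∧ ¬ InnerRow p q r n b₁ b₂ ∧
      ¬ InnerRow p q r n a₁ b₂ ∧ ¬ InnerRow p q r n b₁ a₂ := by
  have hcases := h.interval_cases h1 h2 hc
  have hspec := fun x y => h.meetsOnlyJunction_spec (x := x) (y := y)
  obtain ⟨hr, hs, hm, hn, -⟩ := h
  rcases hcases with ⟨-, g1, g2, g3, g4⟩ | g | g | ⟨g1, g2, g⟩ | ⟨g1, g2, g⟩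
  · simp [hspec _ _ g1, hspec _ _ g2, hspec _ _ g3, hspec _ _ g4]
  · unfold RowInterval at g
    unfold OuterRow at ha hb
    unfold InnerRow
    omega
  · unfold ColInterval at g
    unfold OuterRow at ha hb
    unfold InnerRow
    omega
  · unfold OuterRow at ha hb
    unfold InnerRow
    rcases g with ⟨g3, g4, g5, -⟩ | ⟨g3, g4, g5, -⟩ <;> omega
  · unfold OuterRow at ha hb
    unfold InnerRow
    rcases g with ⟨g3, g4, g5, -⟩ | ⟨g3, g4, g5, -⟩ <;> omega

theorem Attached.not_innerCol (h : Attached p q r s m n c) {a₁ a₂ b₁ b₂ : ℤ}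
    (h1 : a₁ < b₁) (h2 : a₂ < b₂)
    (hc : CellsIn (fun u v => ArmCell p q r s u v ∨ c u v) a₁ a₂ b₁ b₂)
    (ha : ¬ OuterCol p q s m a₁ a₂) (hb : ¬ OuterCol p q s m b₁ b₂) :
    ¬ InnerCol p q s m a₁ a₂ ∧ ¬ InnerCol p q s m b₁ b₂ ∧
      ¬ InnerCol p q s m a₁ b₂ ∧ ¬ InnerCol p q s m b₁ a₂ := by
  obtain ⟨k1, k2, k3, k4⟩ := h.swap.not_innerRow h2 h1
    (fun u v k1 k2 k3 k4 => (hc v u k3 k4 k1 k2).imp_left fun g => g.symm) ha hb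
  exact ⟨k1, k2, k4, k3⟩

/-- Every interval containing an arm cell, including those extending into `c`, has a diagonal corner
on one of the outer sides. -/
theorem Attached.cellsIn_of_avoids (h : Attached p q r s m n c) {a₁ a₂ b₁ b₂ : ℤ}
    (h1 : a₁ < b₁) (h2 : a₂ < b₂)
    (hc : CellsIn (fun u v => ArmCell p q r s u v ∨ c u v) a₁ a₂ b₁ b₂)
    (ha : ¬ OuterRow p q r n a₁ a₂) (hb : ¬ OuterRow p q r n b₁ b₂)
    (ha' : ¬ OuterCol p q s m a₁ a₂) (hb' : ¬ OuterCol p q s m b₁ b₂) :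
    CellsIn c a₁ a₂ b₁ b₂ ∧ MeetsOnlyJunction p q r s m n a₁ a₂ ∧
      MeetsOnlyJunction p q r s m n b₁ b₂ ∧ MeetsOnlyJunction p q r s m n a₁ b₂ ∧
      MeetsOnlyJunction p q r s m n b₁ a₂ := by
  have hcases := h.interval_cases h1 h2 hc
  obtain ⟨hr, hs, hm, hn, -⟩ := h
  unfold OuterRow at ha hb
  unfold OuterCol at ha' hb'
  rcases hcases with g | g | g | ⟨g1, g2, g⟩ | ⟨g1, g2, g⟩
  · exact g
  · unfold RowInterval at g
    omega
  · unfold ColInterval at g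
    omega
  · rcases g with ⟨g3, g4, g5, -⟩ | ⟨g3, g4, g5, -⟩ <;> omega
  · rcases g with ⟨g3, g4, g5, -⟩ | ⟨g3, g4, g5, -⟩ <;> omega

/-- Relabelled points never lie on the outer row, which excludes the horizontal intervals and their
extensions. What survives lies in `c`, in the vertical arm, or extends the latter; only in the
second case can the relabelling move a corner. -/
theorem Attached.relabel_interval (h : Attached p q r s m n c)
    {a₁ a₂ b₁ b₂ c₁ c₂ d₁ d₂ : ℤ}
    (ha : MeetsOnlyJunction p q r s m n a₁ a₂ ∨ ColVertex p q s a₁ a₂)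
    (hb : MeetsOnlyJunction p q r s m n b₁ b₂ ∨ ColVertex p q s b₁ b₂)
    (hd : MeetsOnlyJunction p q r s m n d₁ d₂ ∨ ColVertex p q s d₁ d₂) :
    (a₁ < b₁ ∧ relabel p q n a₁ a₂ < relabel p q n b₁ b₂ ∧
      CellsIn (fun u v => ArmCell p q r s u v ∨ c u v) a₁ (relabel p q n a₁ a₂) b₁
        (relabel p q n b₁ b₂) ∧
      c₁ = a₁ ∧ relabel p q n c₁ c₂ = relabel p q n b₁ b₂ ∧
      d₁ = b₁ ∧ relabel p q n d₁ d₂ = relabel p q n a₁ a₂) →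
    (a₁ < b₁ ∧ a₂ < b₂ ∧ CellsIn (fun u v => ColCell p q s u v ∨ c u v) a₁ a₂ b₁ b₂ ∧
      c₁ = a₁ ∧ c₂ = b₂ ∧ d₁ = b₁ ∧ d₂ = a₂) := by
  rintro ⟨h1, h2, hcell, rfl, h3, rfl, h4⟩
  have hcases := h.interval_cases h1 h2 hcell
  have hspec := fun x y => h.meetsOnlyJunction_spec (x := x) (y := y)
  obtain ⟨hr, hs, hm, hn, -⟩ := h
  have ra := relabel_spec p q n c₁ a₂
  have rb := relabel_spec p q n d₁ b₂
  have rc := relabel_spec p q n c₁ c₂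
  have rd := relabel_spec p q n d₁ d₂
  rcases hcases with ⟨g, g1, g2, g3, g4⟩ | g | g | ⟨g1, g2, g⟩ | ⟨g1, g2, g⟩
  · have e1 := relabel_eq_self_of_relabel hn (hspec _ _ g1).2.2.2
    have e2 := relabel_eq_self_of_relabel hn (hspec _ _ g2).2.2.2
    rw [← h3] at g3
    rw [← h4] at g4
    have e3 := relabel_eq_self_of_relabel hn (hspec _ _ g3).2.2.2
    have e4 := relabel_eq_self_of_relabel hn (hspec _ _ g4).2.2.2
    rw [e3, e2] at h3
    rw [e4, e1] at h4
    rw [e1, e2] at g h2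
    exact ⟨h1, h2, fun u v k1 k2 k3 k4 => Or.inr (g u v k1 k2 k3 k4), rfl, h3, rfl, h4⟩
  · unfold RowInterval at g
    unfold MeetsOnlyJunction ArmVertex JunctionVertex ColVertex at ha hb
    clear hd rc rd h3 h4 hspec hm
    rcases hn with rfl | rfl <;> omega
  · unfold ColInterval at g
    unfold MeetsOnlyJunction ArmVertex JunctionVertex ColVertex at ha hb hd
    refine ⟨h1, by omega, fun u v k1 k2 k3 k4 => Or.inl ?_, rfl, by omega, rfl, by omega⟩
    unfold ColCell
    omega
  · unfold MeetsOnlyJunction ArmVertex JunctionVertex ColVertex at ha hb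
    clear hd rc rd h3 h4 hspec hm
    rcases g with ⟨g3, g4, g5, -⟩ | ⟨g3, g4, g5, -⟩ <;> omega
  · have e1 : relabel p q n c₁ a₂ = a₂ := by omega
    have e2 : relabel p q n d₁ b₂ = b₂ := by omega
    have e3 : c₂ = b₂ := by omega
    have e4 : d₂ = a₂ := by omega
    rw [e1, e2] at hcell h2
    refine ⟨h1, h2, fun u v k1 k2 k3 k4 => (hcell u v k1 k2 k3 k4).imp_left fun k => ?_, rfl, e3,
      rfl, e4⟩
    unfold ArmCell at k
    unfold ColCell
    omega

theorem Attached.interval_relabel (h : Attached p q r s m n c)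
    {a₁ a₂ b₁ b₂ c₁ c₂ d₁ d₂ : ℤ} :
    (a₁ < b₁ ∧ a₂ < b₂ ∧ CellsIn (fun u v => ColCell p q s u v ∨ c u v) a₁ a₂ b₁ b₂ ∧
      c₁ = a₁ ∧ c₂ = b₂ ∧ d₁ = b₁ ∧ d₂ = a₂) →
    (a₁ < b₁ ∧ relabel p q n a₁ a₂ < relabel p q n b₁ b₂ ∧
      CellsIn (fun u v => ArmCell p q r s u v ∨ c u v) a₁ (relabel p q n a₁ a₂) b₁
        (relabel p q n b₁ b₂) ∧
      c₁ = a₁ ∧ relabel p q n c₁ c₂ = relabel p q n b₁ b₂ ∧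
      d₁ = b₁ ∧ relabel p q n d₁ d₂ = relabel p q n a₁ a₂) := by
  rintro ⟨h1, h2, hcell, rfl, rfl, rfl, rfl⟩
  have hcell' : CellsIn (fun u v => ArmCell p q r s u v ∨ c u v) c₁ d₂ d₁ c₂ := by
    intro u v k1 k2 k3 k4
    refine (hcell u v k1 k2 k3 k4).imp_left fun k => ?_
    unfold ColCell at k
    unfold ArmCell
    omega
  -- The interval contains no cell of the removed row, neither as a cell of the shortened arm nor as
  -- a cell of `c`.
  have hq : ∀ u, c₁ ≤ u → u < d₁ → d₂ ≤ q → q < c₂ → p ≤ u → u ≤ p + r → False := by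
    intro u k1 k2 k3 k4 k5 k6
    rcases hcell u q k1 k2 k3 k4 with k | k
    · unfold ColCell at k
      omega
    · exact h.not_armCell k (Or.inl ⟨rfl, k5, k6⟩)
  have hcases := h.interval_cases h1 h2 hcell'
  have hspec := fun x y => h.meetsOnlyJunction_spec (x := x) (y := y)
  obtain ⟨hr, hs, hm, hn, -⟩ := h
  have ra := relabel_spec p q n c₁ d₂
  have rb := relabel_spec p q n d₁ c₂
  have rc := relabel_spec p q n c₁ c₂
  have rd := relabel_spec p q n d₁ d₂
  rcases hcases with ⟨g, g1, g2, g3, g4⟩ | g | g | ⟨g1, g2, g⟩ | ⟨g1, g2, g⟩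
  · have e1 := relabel_eq_self (n := n) (hspec _ _ g1).2.2.2
    have e2 := relabel_eq_self (n := n) (hspec _ _ g2).2.2.2
    have e3 := relabel_eq_self (n := n) (hspec _ _ g3).2.2.2
    have e4 := relabel_eq_self (n := n) (hspec _ _ g4).2.2.2
    rw [e1, e2, e3, e4]
    exact ⟨h1, h2, hcell', rfl, rfl, rfl, rfl⟩
  · unfold RowInterval at g
    exfalso
    clear ra rb rc rd
    exact hq c₁ (by omega) (by omega) (by omega) (by omega) (by omega) (by omega)
  · unfold ColInterval at g
    have hd : q + 1 ≤ d₂ := by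
      by_contra hlt
      exact hq p (by omega) (by omega) (by omega) (by omega) (by omega) (by omega)
    clear hq hspec hm
    have e2 : relabel p q n d₁ c₂ = c₂ := by clear ra rc rd; omega
    have e3 : relabel p q n c₁ c₂ = c₂ := by clear ra rb rd; omega
    have e4 : relabel p q n d₁ d₂ = relabel p q n c₁ d₂ := by clear rb rc; omega
    have e5 : q ≤ relabel p q n c₁ d₂ ∧ relabel p q n c₁ d₂ ≤ d₂ := by clear rb rc rd; omega
    rw [e2, e3, e4]
    clear ra rb rc rd
    refine ⟨h1, by omega, fun u v k1 k2 k3 k4 => Or.inl ?_, rfl, rfl, rfl, rfl⟩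
    unfold ArmCell
    omega
  · exfalso
    clear ra rb rc rd
    rcases g with ⟨g3, g4, g5, -⟩ | ⟨g3, g4, g5, -⟩ <;>
    exact hq (p + r) (by omega) (by omega) (by omega) (by omega) (by omega) (by omega)
  · have e1 : relabel p q n c₁ d₂ = d₂ := by omega
    have e2 : relabel p q n d₁ c₂ = c₂ := by omega
    have e3 : relabel p q n c₁ c₂ = c₂ := by omega
    have e4 : relabel p q n d₁ d₂ = d₂ := by omega
    rw [e1, e2, e3, e4]
    exact ⟨h1, h2, hcell', rfl, rfl, rfl, rfl⟩

/-- For `n = 1` nothing moves; for `n = 0` the target height `q` is vacant above `p` and `p + 1`,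
since the corner cell has no junction vertices. -/
theorem Attached.relabel_injective (h : Attached p q r s m n c) {x y y' : ℤ}
    (hy : MeetsOnlyJunction p q r s m n x y ∨ ColVertex p q s x y)
    (hy' : MeetsOnlyJunction p q r s m n x y' ∨ ColVertex p q s x y')
    (heq : relabel p q n x y = relabel p q n x y') : y = y' := by
  obtain ⟨hr, hs, hm, hn, -⟩ := h
  have r1 := relabel_spec p q n x y
  have r2 := relabel_spec p q n x y'
  unfold MeetsOnlyJunction ArmVertex JunctionVertex ColVertex at hy hy'
  omega

theorem Attached.exists_relabel_iff (h : Attached p q r s m n c) {x y : ℤ}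
    (hxy : ArmVertex p q r s x y ∨ CornerOf c x y) :
    ¬ (OuterRow p q r n x y ∨ InnerRow p q r n x y) ↔
      ∃ y', (ColVertex p q s x y' ∨ CornerOf c x y') ∧ relabel p q n x y' = y := by
  have hcor := h.corner_iff
  obtain ⟨hr, hs, hm, hn, -⟩ := h
  constructor
  · intro hno
    have hcor := hcor x y
    unfold OuterRow InnerRow at hno
    by_cases h1 : p ≤ x ∧ x ≤ p + 1 ∧ y = q + n
    -- The corners of the corner cell that survive have height `q + n`; they come from the lower
    -- end, at height `q + 1`, of the shortened vertical arm.
    · refine ⟨q + 1, Or.inl ⟨h1.1, h1.2.1, by omega, by omega⟩, ?_⟩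
      have := relabel_spec p q n x (q + 1)
      omega
    · refine ⟨y, ?_, ?_⟩
      · by_cases hc : CornerOf c x y
        · exact Or.inr hc
        · left
          simp only [hc, false_iff, or_false] at hcor hxy
          have := hcor hxy
          unfold ArmVertex at hxy
          unfold JunctionVertex at this
          unfold ColVertex
          omega
      · have := relabel_spec p q n x y
        by_cases hc : CornerOf c x y
        · simp only [hc, true_iff] at hcor
          unfold ArmVertex JunctionVertex at hcor
          omega
        · simp only [hc, or_false] at hxy
          unfold ArmVertex at hxy
          omega
  · rintro ⟨y', hy', rfl⟩
    have hs := relabel_spec p q n x y'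
    have hcor := hcor x y'
    unfold OuterRow InnerRow
    rcases hy' with hy' | hy'
    · unfold ColVertex at hy'
      omega
    · simp only [hy', true_iff] at hcor
      unfold ArmVertex JunctionVertex at hcor
      omega

/-- An arm interval containing `A`, `A_1` or `B_1` starts at a corner of `A`. Hence killing the
corners of `A` discards exactly the minors lost on deleting these three cells. -/
theorem Attached.cellsIn_sdiff_corner (h : Attached p q r s m n c) {a₁ a₂ b₁ b₂ : ℤ}
    (h1 : a₁ < b₁) (h2 : a₂ < b₂)
    (hc : CellsIn (fun u v => ArmCell p q r s u v ∨ c u v) a₁ a₂ b₁ b₂)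
    (ha : ¬ CornerCell p q a₁ a₂) :
    CellsIn (fun u v => (ArmCell p q r s u v ∨ c u v) ∧ ¬ (u = p ∧ v = q) ∧
      ¬ (u = p + 1 ∧ v = q) ∧ ¬ (u = p ∧ v = q + 1)) a₁ a₂ b₁ b₂ := by
  have hcases := h.interval_cases h1 h2 hc
  have hnot := fun u v => h.not_armCell (u := u) (v := v)
  obtain ⟨hr, hs, hm, hn, -⟩ := h
  unfold CornerCell at ha
  intro u v k1 k2 k3 k4
  refine ⟨hc u v k1 k2 k3 k4, ?_⟩
  rcases hcases with ⟨g, -⟩ | g | g | ⟨g1, g2, g⟩ | ⟨g1, g2, g⟩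
  · have := hnot u v (g u v k1 k2 k3 k4)
    unfold ArmCell at this
    omega
  · unfold RowInterval at g
    omega
  · unfold ColInterval at g
    omega
  · clear hnot
    omega
  · clear hnot
    omega

/-- The union of the regions of the horizontal arm, the vertical arm and the remaining vertex of
the corner cell consists of the vertices of the L-shape that are not vertices of `c`. -/
theorem Attached.cornerOf_iff (h : Attached p q r s m n c) {x y : ℤ}
    (hxy : ArmVertex p q r s x y ∨ CornerOf c x y) :
    ¬ ((OuterRow p q r n x y ∨ OuterCol p q s m x y) ∨ InnerRow p q r n x y ∨
      InnerCol p q s m x y ∨ (x = p + m ∧ y = q + n)) ↔ CornerOf c x y := by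
  have hcor := h.corner_iff x y
  obtain ⟨hr, hs, hm, hn, -⟩ := h
  unfold OuterRow OuterCol InnerRow InnerCol
  by_cases hc : CornerOf c x y
  · simp only [hc, true_iff, iff_true] at hcor ⊢
    unfold ArmVertex JunctionVertex at hcor
    omega
  · simp only [hc, false_iff, iff_false, or_false] at hcor hxy ⊢
    have := hcor hxy
    unfold ArmVertex at hxy
    unfold JunctionVertex at this
    clear hcor
    rcases hm with rfl | rfl <;> rcases hn with rfl | rfl <;> omega

theorem cornerOf_or (c c' : ℤ → ℤ → Prop) (x y : ℤ) :
    CornerOf (fun u v => c u v ∨ c' u v) x y ↔ CornerOf c x y ∨ CornerOf c' x y := by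
  unfold CornerOf
  tauto

theorem cornerOf_armCell (hr : 0 ≤ r) (hs : 0 ≤ s) (x y : ℤ) :
    CornerOf (ArmCell p q r s) x y ↔ ArmVertex p q r s x y := by
  unfold CornerOf ArmCell ArmVertex
  omega

theorem cornerOf_colCell (hs : 1 ≤ s) (x y : ℤ) :
    CornerOf (ColCell p q s) x y ↔ ColVertex p q s x y := by
  unfold CornerOf ColCell ColVertex
  omega

/-- Since `r, s ≥ 2`, the far corners of `A_1` and `B_1` are still corners of `A_2` and `B_2`, so
only the corners of `A` disappear. -/
theorem Attached.cornerOf_sdiff_corner (h : Attached p q r s m n c) {x y : ℤ} :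
    CornerOf (fun u v => (ArmCell p q r s u v ∨ c u v) ∧ ¬ (u = p ∧ v = q) ∧
      ¬ (u = p + 1 ∧ v = q) ∧ ¬ (u = p ∧ v = q + 1)) x y ↔
    (ArmVertex p q r s x y ∨ CornerOf c x y) ∧ ¬ CornerCell p q x y := by
  have hcor := h.corner_iff x y
  have hnot := fun u v => h.not_armCell (u := u) (v := v)
  have hnot' : ∀ u v, c u v → ¬ (u = p ∧ v = q) ∧
      ¬ (u = p + 1 ∧ v = q) ∧ ¬ (u = p ∧ v = q + 1) := by
    intro u v huv
    have := hnot u v huv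
    have := h.two_le_r
    have := h.two_le_s
    unfold ArmCell at *
    omega
  have hcell : ∀ u v, ((ArmCell p q r s u v ∨ c u v) ∧ ¬ (u = p ∧ v = q) ∧
      ¬ (u = p + 1 ∧ v = q) ∧ ¬ (u = p ∧ v = q + 1)) ↔
      ((v = q ∧ p + 2 ≤ u ∧ u ≤ p + r) ∨ (u = p ∧ q + 2 ≤ v ∧ v ≤ q + s)) ∨ c u v := by
    intro u v
    by_cases huv : c u v
    · simp only [huv, or_true, true_and, iff_true]
      exact hnot' u v huv
    · have := h.two_le_r
      have := h.two_le_s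
      simp only [huv, or_false]
      unfold ArmCell
      omega
  simp only [hcell]
  rw [cornerOf_or]
  obtain ⟨hr, hs, hm, hn, -⟩ := h
  by_cases hc : CornerOf c x y
  · simp only [hc, true_iff, or_true, true_and] at hcor ⊢
    unfold CornerCell
    unfold ArmVertex JunctionVertex at hcor
    omega
  · simp only [hc, or_false]
    unfold CornerOf ArmVertex CornerCell
    omega

end Regions

/-! ### From polyomino ideals to binomial ideals and lattice coordinates -/

section Bridge

theorem mem_vertexSet_iff (P : Finset Cell) (x y : ℤ) :
    (x, y) ∈ vertexSet P ↔ CornerOf (fun u v => (u, v) ∈ P) x y := by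
  simp only [vertexSet, Finset.mem_biUnion, cellVertices, lowerLeft, lowerRight, upperLeft,
    upperRight, Finset.mem_insert, Finset.mem_singleton, CornerOf]
  constructor
  · rintro ⟨⟨u, v⟩, hC, h | h | h | h⟩ <;>
    simp only [Prod.mk_add_mk, add_zero, Prod.mk.injEq] at h <;> obtain ⟨rfl, rfl⟩ := h <;>
    simp [hC]
  · rintro (h | h | h | h)
    · exact ⟨_, h, by simp⟩
    · exact ⟨_, h, by simp⟩
    · exact ⟨_, h, by simp⟩
    · exact ⟨_, h, by simp⟩

theorem isInnerInterval_iff (P : Finset Cell) (a b : ℤ × ℤ) :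
    IsInnerInterval P a b ↔ a.1 < b.1 ∧ a.2 < b.2 ∧
      CellsIn (fun u v => (u, v) ∈ P) a.1 a.2 b.1 b.2 := by
  unfold IsInnerInterval CellsIn
  simp only [Prod.forall]

/-- `a, b` are the diagonal and `c, d` the anti-diagonal corners of an inner interval of `P`. -/
def InnerCorners (P : Finset Cell) (a b c d : ℤ × ℤ) : Prop :=
  IsInnerInterval P a b ∧ c = (a.1, b.2) ∧ d = (b.1, a.2)

/-- The relation `InnerCorners` on the vertices of `P`. -/
def innerRel (P : Finset Cell) (a b c d : vertexSet P) : Prop :=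
  InnerCorners P a b c d

theorem polyominoIdeal_eq (K : Type*) [Field K] (P : Finset Cell) :
    polyominoIdeal K P = binomialIdeal K (innerRel P) ∅ := by
  unfold polyominoIdeal binomialIdeal innerRel InnerCorners
  simp only [Set.image_empty, Set.union_empty, and_assoc]

theorem HP_eq (K : Type*) [Field K] (P : Finset Cell) :
    HP K P = hilbertSeries (binomialIdeal K (innerRel P) ∅) := by
  rw [← polyominoIdeal_eq]
  rfl

theorem isSquarefree_innerRel (P : Finset Cell) : IsSquarefree (innerRel P) := by
  rintro a b c d ⟨⟨h1, -⟩, h2, h3⟩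
  refine ⟨fun h => ?_, fun h => ?_⟩
  · rw [h] at h1
    exact lt_irrefl _ h1
  · rw [← h, h2, Prod.mk.injEq] at h3
    omega

/-- The vertices of `P` whose coordinates satisfy `R`. -/
def region (P : Finset Cell) (R : ℤ → ℤ → Prop) : Set (vertexSet P) :=
  {z | R z.1.1 z.1.2}

theorem mem_region {P : Finset Cell} {R : ℤ → ℤ → Prop} {z : vertexSet P} :
    z ∈ region P R ↔ R z.1.1 z.1.2 := Iff.rfl

theorem isFace_region {P : Finset Cell} {R : ℤ → ℤ → Prop}
    (H : ∀ a₁ a₂ b₁ b₂, a₁ < b₁ → a₂ < b₂ → CellsIn (fun u v => (u, v) ∈ P) a₁ a₂ b₁ b₂ →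
      ((R a₁ a₂ ∨ R b₁ b₂) ↔ (R a₁ b₂ ∨ R b₁ a₂))) : IsFace (innerRel P) (region P R) := by
  rintro a b c d ⟨h, hc, hd⟩
  rw [isInnerInterval_iff] at h
  simp only [mem_region, hc, hd]
  exact H _ _ _ _ h.1 h.2.1 h.2.2

/-- Free variables of the quotient by a region. -/
theorem hilbertSeries_region_or {K : Type*} [Field K] {P : Finset Cell} {R R' : ℤ → ℤ → Prop}
    (hprime : (binomialIdeal K (innerRel P) ∅).IsPrime) (hR : IsFace (innerRel P) (region P R))
    (F : Finset (ℤ × ℤ)) (hF : ∀ x y, (x, y) ∈ F ↔ R' x y)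
    (hFP : F ⊆ vertexSet P) (hdisj : ∀ x y, R' x y → ¬ R x y)
    (H : ∀ a₁ a₂ b₁ b₂, a₁ < b₁ → a₂ < b₂ → CellsIn (fun u v => (u, v) ∈ P) a₁ a₂ b₁ b₂ →
      ¬ R a₁ a₂ → ¬ R b₁ b₂ → ¬ R a₁ b₂ → ¬ R b₁ a₂ →
      ¬ R' a₁ a₂ ∧ ¬ R' b₁ b₂ ∧ ¬ R' a₁ b₂ ∧ ¬ R' b₁ a₂) :
    IsFace (innerRel P) (region P fun x y => R x y ∨ R' x y) ∧
    hilbertSeries (binomialIdeal K (innerRel P) (region P R)) = ((1 - PowerSeries.X)⁻¹) ^ F.card *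
      hilbertSeries (binomialIdeal K (innerRel P) (region P fun x y => R x y ∨ R' x y)) := by
  classical
  let F' : Finset (vertexSet P) := F.subtype (· ∈ vertexSet P)
  have hF' : ∀ z : vertexSet P, z ∈ F' ↔ R' z.1.1 z.1.2 := fun z => by
    rw [Finset.mem_subtype]
    exact hF _ _
  have hcard : F'.card = F.card := by
    rw [Finset.card_subtype, Finset.filter_true_of_mem fun z hz => hFP hz]
  have hfree : ∀ a b c d, innerRel P a b c d → a ∉ region P R → b ∉ region P R →
      c ∉ region P R → d ∉ region P R → a ∉ F' ∧ b ∉ F' ∧ c ∉ F' ∧ d ∉ F' := by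
    rintro a b c d ⟨h, hc, hd⟩
    rw [isInnerInterval_iff] at h
    simp only [mem_region, hF', hc, hd]
    exact H _ _ _ _ h.1 h.2.1 h.2.2
  have hunion : region P R ∪ F' = region P fun x y => R x y ∨ R' x y := by
    ext z
    simp only [Set.mem_union, mem_region, Finset.mem_coe, hF']
  refine ⟨?_, ?_⟩
  · intro a b c d h
    have h1 := hR a b c d h
    have h2 := hfree a b c d h
    rw [← hunion]
    simp only [Set.mem_union, Finset.mem_coe]
    grind
  · rw [← hcard, ← hunion]
    exact hR.hilbertSeries_union (isSquarefree_innerRel P) hprime F'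
      (fun z hz => hdisj _ _ ((hF' z).mp hz)) hfree

theorem hilbertSeries_region_eq_HP {K : Type*} [Field K] {P Q : Finset Cell} {R : ℤ → ℤ → Prop}
    (hR : IsFace (innerRel P) (region P R)) (e : ℤ × ℤ → ℤ × ℤ)
    (hmaps : ∀ t ∈ vertexSet Q, e t ∈ vertexSet P)
    (hinj : ∀ t ∈ vertexSet Q, ∀ t' ∈ vertexSet Q, e t = e t' → t = t')
    (hrange : ∀ z ∈ vertexSet P, ¬ R z.1 z.2 ↔ ∃ t ∈ vertexSet Q, e t = z)
    (hquad : ∀ a ∈ vertexSet Q, ∀ b ∈ vertexSet Q, ∀ c ∈ vertexSet Q, ∀ d ∈ vertexSet Q,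
      InnerCorners P (e a) (e b) (e c) (e d) ↔ InnerCorners Q a b c d) :
    hilbertSeries (binomialIdeal K (innerRel P) (region P R)) = HP K Q := by
  rw [HP_eq]
  refine hilbertSeries_binomialIdeal_eq hR (fun t => ⟨e t.1, hmaps _ t.2⟩) ?_ ?_ ?_
  · intro t t' h
    exact Subtype.ext (hinj _ t.2 _ t'.2 (congrArg Subtype.val h))
  · intro z
    rw [mem_region, hrange _ z.2]
    simp only [Subtype.exists, Subtype.ext_iff, exists_prop]
  · exact fun a b c d => hquad _ a.2 _ b.2 _ c.2 _ d.2

/-- The disjunction lets `a, b` be either the diagonal or the anti-diagonal pair, so the four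
junction types need no separate treatment of signs. -/
theorem X_mul_X_mem_of_innerRel {K : Type*} [Field K] {P : Finset Cell} {Z : Set (vertexSet P)}
    {a b c d : vertexSet P} (h : innerRel P a b c d ∨ innerRel P c d a b) (hc : c ∈ Z ∨ d ∈ Z) :
    (X a * X b : MvPolynomial (vertexSet P) K) ∈ binomialIdeal K (innerRel P) Z := by
  have h1 : (X c * X d : MvPolynomial (vertexSet P) K) ∈ binomialIdeal K (innerRel P) Z := by
    rcases hc with hc | hc
    · exact Ideal.mul_mem_right _ _ (X_mem_binomialIdeal hc)
    · exact Ideal.mul_mem_left _ _ (X_mem_binomialIdeal hc)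
  rcases h with h | h
  · simpa using Ideal.add_mem _ (binomial_mem_binomialIdeal h) h1
  · simpa using Ideal.sub_mem _ h1 (binomial_mem_binomialIdeal h)

variable {K : Type*} [Field K] {P C : Finset Cell} {p q r s m n : ℤ}

theorem innerCorners_row (hP : ∀ u v, (u, v) ∈ P ↔ ArmCell p q r s u v ∨ (u, v) ∈ C) {i j : ℤ}
    (hi : p ≤ i) (hij : i < j) (hj : j ≤ p + r + 1) :
    InnerCorners P (i, q) (j, q + 1) (i, q + 1) (j, q) := by
  refine ⟨⟨hij, by simp, ?_⟩, rfl, rfl⟩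
  rintro ⟨u, v⟩ h1 h2 h3 h4
  simp only at h1 h2 h3 h4
  exact (hP u v).mpr (Or.inl (Or.inl (by omega)))

theorem innerCorners_col (hP : ∀ u v, (u, v) ∈ P ↔ ArmCell p q r s u v ∨ (u, v) ∈ C) {i j : ℤ}
    (hi : q ≤ i) (hij : i < j) (hj : j ≤ q + s + 1) :
    InnerCorners P (p, i) (p + 1, j) (p, j) (p + 1, i) := by
  refine ⟨⟨by simp, hij, ?_⟩, rfl, rfl⟩
  rintro ⟨u, v⟩ h1 h2 h3 h4
  simp only at h1 h2 h3 h4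
  exact (hP u v).mpr (Or.inl (Or.inr (by omega)))

/-- The points `a` and `b` are opposite corners of an interval of the arm having `c` as a third
corner, or `b = c` when `i = j`. This gives the easy inclusion for the colon ideals. -/
theorem X_mul_X_mem_row (hP : ∀ u v, (u, v) ∈ P ↔ ArmCell p q r s u v ∨ (u, v) ∈ C)
    {Z : Set (vertexSet P)} {i j : ℤ} (hn : n = 0 ∨ n = 1)
    (hi : p ≤ i) (hi' : i ≤ p + r + 1) (hj : p ≤ j) (hj' : j ≤ p + r + 1) {a b c : vertexSet P}
    (ha : a.1 = (i, q + n)) (hb : b.1 = (j, q + 1 - n)) (hc : c.1 = (i, q + 1 - n)) (hcZ : c ∈ Z) :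
    (X a * X b : MvPolynomial (vertexSet P) K) ∈ binomialIdeal K (innerRel P) Z := by
  rcases eq_or_ne i j with rfl | hne
  · obtain rfl : b = c := Subtype.ext (hb.trans hc.symm)
    exact Ideal.mul_mem_left _ _ (X_mem_binomialIdeal hcZ)
  have hd : (j, q + n) ∈ vertexSet P := by
    rcases lt_or_gt_of_ne hne with hlt | hlt
    · have := (innerCorners_row hP hi hlt hj').1.corners_mem
      rcases hn with rfl | rfl
      · simpa using this.2.2.2
      · simpa using this.2.1
    · have := (innerCorners_row hP hj hlt hi').1.corners_mem
      rcases hn with rfl | rfl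
      · simpa using this.1
      · simpa using this.2.2.1
  obtain ⟨a, a_mem⟩ := a
  obtain ⟨b, b_mem⟩ := b
  obtain ⟨c, c_mem⟩ := c
  simp only at ha hb hc
  subst ha hb hc
  rcases lt_or_gt_of_ne hne with hlt | hlt
  · have h := innerCorners_row hP hi hlt hj'
    refine X_mul_X_mem_of_innerRel (c := ⟨_, c_mem⟩) (d := ⟨_, hd⟩) ?_ (Or.inl hcZ)
    rcases hn with rfl | rfl
    · left
      simpa [innerRel] using h
    · right
      simpa [innerRel] using h
  · have h := innerCorners_row hP hj hlt hi'
    rw [mul_comm]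
    refine X_mul_X_mem_of_innerRel (c := ⟨_, hd⟩) (d := ⟨_, c_mem⟩) ?_ (Or.inr hcZ)
    rcases hn with rfl | rfl
    · right
      simpa [innerRel] using h
    · left
      simpa [innerRel] using h

theorem X_mul_X_mem_col (hP : ∀ u v, (u, v) ∈ P ↔ ArmCell p q r s u v ∨ (u, v) ∈ C)
    {Z : Set (vertexSet P)} {i j : ℤ} (hm : m = 0 ∨ m = 1)
    (hi : q ≤ i) (hi' : i ≤ q + s + 1) (hj : q ≤ j) (hj' : j ≤ q + s + 1) {a b c : vertexSet P}
    (ha : a.1 = (p + m, i)) (hb : b.1 = (p + 1 - m, j)) (hc : c.1 = (p + 1 - m, i)) (hcZ : c ∈ Z) :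
    (X a * X b : MvPolynomial (vertexSet P) K) ∈ binomialIdeal K (innerRel P) Z := by
  rcases eq_or_ne i j with rfl | hne
  · obtain rfl : b = c := Subtype.ext (hb.trans hc.symm)
    exact Ideal.mul_mem_left _ _ (X_mem_binomialIdeal hcZ)
  have hd : (p + m, j) ∈ vertexSet P := by
    rcases lt_or_gt_of_ne hne with hlt | hlt
    · have := (innerCorners_col hP hi hlt hj').1.corners_mem
      rcases hm with rfl | rfl
      · simpa using this.2.2.1
      · simpa using this.2.1
    · have := (innerCorners_col hP hj hlt hi').1.corners_mem
      rcases hm with rfl | rfl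
      · simpa using this.1
      · simpa using this.2.2.2
  obtain ⟨a, a_mem⟩ := a
  obtain ⟨b, b_mem⟩ := b
  obtain ⟨c, c_mem⟩ := c
  simp only at ha hb hc
  subst ha hb hc
  rcases lt_or_gt_of_ne hne with hlt | hlt
  · have h := innerCorners_col hP hi hlt hj'
    rcases hm with rfl | rfl
    · refine X_mul_X_mem_of_innerRel (c := ⟨_, hd⟩) (d := ⟨_, c_mem⟩) (Or.inl ?_) (Or.inr hcZ)
      simpa [innerRel] using h
    · rw [mul_comm]
      refine X_mul_X_mem_of_innerRel (c := ⟨_, c_mem⟩) (d := ⟨_, hd⟩) (Or.inr ?_) (Or.inl hcZ)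
      simpa [innerRel] using h
  · have h := innerCorners_col hP hj hlt hi'
    rcases hm with rfl | rfl
    · refine X_mul_X_mem_of_innerRel (c := ⟨_, hd⟩) (d := ⟨_, c_mem⟩) (Or.inr ?_) (Or.inr hcZ)
      simpa [innerRel] using h
    · rw [mul_comm]
      refine X_mul_X_mem_of_innerRel (c := ⟨_, c_mem⟩) (d := ⟨_, hd⟩) (Or.inl ?_) (Or.inl hcZ)
      simpa [innerRel] using h

end Bridge

/-! ### Identification of the face quotients with `P₁`, `P₂`, `C` and `P₄` -/

section Regions

variable {K : Type*} [Field K] {P Q C : Finset Cell} {p q r s m n : ℤ}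

theorem cells_eq {c : ℤ → ℤ → Prop} (hP : ∀ u v, (u, v) ∈ P ↔ c u v) :
    (fun u v => (u, v) ∈ P) = c :=
  funext fun u => funext fun v => propext (hP u v)

theorem mem_vertexSet_of_cells {c : ℤ → ℤ → Prop}
    (hQ : ∀ u v, (u, v) ∈ Q ↔ c u v ∨ (u, v) ∈ C) (x y : ℤ) :
    (x, y) ∈ vertexSet Q ↔ CornerOf c x y ∨ CornerOf (fun u v => (u, v) ∈ C) x y := by
  rw [mem_vertexSet_iff, cells_eq hQ, cornerOf_or]

theorem Attached.mem_vertexSet (h : Attached p q r s m n fun u v => (u, v) ∈ C)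
    (hP : ∀ u v, (u, v) ∈ P ↔ ArmCell p q r s u v ∨ (u, v) ∈ C) (x y : ℤ) :
    (x, y) ∈ vertexSet P ↔ ArmVertex p q r s x y ∨ CornerOf (fun u v => (u, v) ∈ C) x y := by
  have := h.two_le_r
  have := h.two_le_s
  rw [mem_vertexSet_of_cells hP, cornerOf_armCell (by omega) (by omega)]

theorem Attached.meetsOnlyJunction (h : Attached p q r s m n fun u v => (u, v) ∈ C) {x y : ℤ}
    (hxy : CornerOf (fun u v => (u, v) ∈ C) x y) : MeetsOnlyJunction p q r s m n x y :=
  fun hv => (h.corner_iff x y hv).mp hxy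

theorem Attached.isFace_outerRow (h : Attached p q r s m n fun u v => (u, v) ∈ C)
    (hP : ∀ u v, (u, v) ∈ P ↔ ArmCell p q r s u v ∨ (u, v) ∈ C) :
    IsFace (innerRel P) (region P (OuterRow p q r n)) := by
  apply isFace_region
  rw [cells_eq hP]
  exact fun a₁ a₂ b₁ b₂ => h.outerRow_iff

theorem Attached.isFace_outerCol (h : Attached p q r s m n fun u v => (u, v) ∈ C)
    (hP : ∀ u v, (u, v) ∈ P ↔ ArmCell p q r s u v ∨ (u, v) ∈ C) :
    IsFace (innerRel P) (region P (OuterCol p q s m)) := by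
  apply isFace_region
  rw [cells_eq hP]
  exact fun a₁ a₂ b₁ b₂ => h.outerCol_iff

theorem Attached.isFace_cornerCell (h : Attached p q r s m n fun u v => (u, v) ∈ C)
    (hP : ∀ u v, (u, v) ∈ P ↔ ArmCell p q r s u v ∨ (u, v) ∈ C) :
    IsFace (innerRel P) (region P (CornerCell p q)) := by
  apply isFace_region
  rw [cells_eq hP]
  exact fun a₁ a₂ b₁ b₂ => h.cornerCell_iff

theorem innerCorners_iff {c : ℤ → ℤ → Prop} (hP : ∀ u v, (u, v) ∈ P ↔ c u v)
    (a₁ a₂ b₁ b₂ c₁ c₂ d₁ d₂ : ℤ) :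
    InnerCorners P (a₁, a₂) (b₁, b₂) (c₁, c₂) (d₁, d₂) ↔
      a₁ < b₁ ∧ a₂ < b₂ ∧ CellsIn c a₁ a₂ b₁ b₂ ∧ c₁ = a₁ ∧ c₂ = b₂ ∧ d₁ = b₁ ∧ d₂ = a₂ := by
  unfold InnerCorners
  rw [isInnerInterval_iff, cells_eq hP]
  simp only [Prod.mk.injEq]
  tauto

/-- After the `r - 2` inner row variables are split off, the remaining vertices correspond to those
of `Q` under `relabel`, and inner intervals correspond to inner intervals. -/
theorem Attached.hilbertSeries_outerRow (h : Attached p q r s m n fun u v => (u, v) ∈ C)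
    (hP : ∀ u v, (u, v) ∈ P ↔ ArmCell p q r s u v ∨ (u, v) ∈ C)
    (hQ : ∀ u v, (u, v) ∈ Q ↔ ColCell p q s u v ∨ (u, v) ∈ C)
    (hprime : (binomialIdeal K (innerRel P) ∅).IsPrime) :
    hilbertSeries (binomialIdeal K (innerRel P) (region P (OuterRow p q r n))) =
      ((1 - PowerSeries.X)⁻¹) ^ (r - 2).toNat * HP K Q := by
  have hr := h.two_le_r
  have hs := h.two_le_s
  have hn := h.n_eq
  have hVP := h.mem_vertexSet hP
  have hVQ : ∀ x y, (x, y) ∈ vertexSet Q ↔ ColVertex p q s x y ∨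
      CornerOf (fun u v => (u, v) ∈ C) x y := fun x y => by
    rw [mem_vertexSet_of_cells hQ, cornerOf_colCell (by omega)]
  have hVQ' : ∀ x y, (x, y) ∈ vertexSet Q → MeetsOnlyJunction p q r s m n x y ∨
      ColVertex p q s x y := fun x y hxy =>
    ((hVQ x y).mp hxy).symm.imp_left h.meetsOnlyJunction
  obtain ⟨hface, heq⟩ := hilbertSeries_region_or (R' := InnerRow p q r n) hprime
    (h.isFace_outerRow hP) (Finset.Icc (p + 2) (p + r - 1) ×ˢ {q + n})
    (fun x y => by
      simp only [Finset.mem_product, Finset.mem_Icc, Finset.mem_singleton, InnerRow]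
      tauto)
    (fun ⟨x, y⟩ hxy => by
      simp only [Finset.mem_product, Finset.mem_Icc, Finset.mem_singleton] at hxy
      exact (hVP x y).mpr (Or.inl (Or.inl (by omega))))
    (fun x y => by
      unfold InnerRow OuterRow
      omega)
    (by
      rw [cells_eq hP]
      exact fun a₁ a₂ b₁ b₂ h1 h2 hc ha hb _ _ => h.not_innerRow h1 h2 hc ha hb)
  rw [heq, Finset.card_product, Int.card_Icc, Finset.card_singleton, mul_one,
    show p + r - 1 + 1 - (p + 2) = r - 2 by ring]
  congr 1
  refine hilbertSeries_region_eq_HP hface (fun t => (t.1, relabel p q n t.1 t.2)) ?_ ?_ ?_ ?_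
  · rintro ⟨x, y⟩ ht
    rw [hVQ] at ht
    rw [hVP]
    rcases relabel_spec p q n x y with ⟨h1, h2, h3, h4⟩ | ⟨-, h4⟩
    · left
      simp only [h4]
      exact Or.inl (by omega)
    · simp only [h4]
      refine ht.imp_left fun ht => Or.inr ?_
      unfold ColVertex at ht
      omega
  · rintro ⟨x, y⟩ ht ⟨x', y'⟩ ht' heq
    simp only [Prod.mk.injEq] at heq
    obtain ⟨rfl, heq⟩ := heq
    rw [h.relabel_injective (hVQ' _ _ ht) (hVQ' _ _ ht') heq]
  · rintro ⟨x, y⟩ ht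
    rw [h.exists_relabel_iff ((hVP x y).mp ht)]
    constructor
    · rintro ⟨y', h1, h2⟩
      exact ⟨(x, y'), (hVQ _ _).mpr h1, by simp [h2]⟩
    · rintro ⟨⟨x', y'⟩, h1, h2⟩
      simp only [Prod.mk.injEq] at h2
      obtain ⟨rfl, h2⟩ := h2
      exact ⟨y', (hVQ _ _).mp h1, h2⟩
  · rintro ⟨a₁, a₂⟩ ha ⟨b₁, b₂⟩ hb ⟨c₁, c₂⟩ hc ⟨d₁, d₂⟩ hd
    rw [innerCorners_iff hP, innerCorners_iff hQ]
    exact ⟨h.relabel_interval (hVQ' _ _ ha) (hVQ' _ _ hb) (hVQ' _ _ hd), h.interval_relabel⟩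

theorem cellsIn_swap {c : ℤ → ℤ → Prop} {a₁ a₂ b₁ b₂ : ℤ} :
    CellsIn (fun u v => c v u) a₂ a₁ b₂ b₁ ↔ CellsIn c a₁ a₂ b₁ b₂ :=
  ⟨fun h u v h1 h2 h3 h4 => h v u h3 h4 h1 h2, fun h u v h1 h2 h3 h4 => h v u h3 h4 h1 h2⟩

theorem cornerOf_swap {c : ℤ → ℤ → Prop} {x y : ℤ} :
    CornerOf (fun u v => c v u) y x ↔ CornerOf c x y := by
  unfold CornerOf
  tauto

theorem armVertex_swap {x y : ℤ} : ArmVertex q p s r y x ↔ ArmVertex p q r s x y := or_comm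

theorem meetsOnlyJunction_swap {x y : ℤ} :
    MeetsOnlyJunction q p s r n m y x ↔ MeetsOnlyJunction p q r s m n x y := by
  unfold MeetsOnlyJunction
  rw [armVertex_swap]
  exact imp_congr_right fun _ => or_comm

theorem Attached.hilbertSeries_outerCol (h : Attached p q r s m n fun u v => (u, v) ∈ C)
    (hP : ∀ u v, (u, v) ∈ P ↔ ArmCell p q r s u v ∨ (u, v) ∈ C)
    (hQ : ∀ u v, (u, v) ∈ Q ↔ ColCell q p r v u ∨ (u, v) ∈ C)
    (hprime : (binomialIdeal K (innerRel P) ∅).IsPrime) :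
    hilbertSeries (binomialIdeal K (innerRel P) (region P (OuterCol p q s m))) =
      ((1 - PowerSeries.X)⁻¹) ^ (s - 2).toNat * HP K Q := by
  have hr := h.two_le_r
  have hs := h.two_le_s
  have hm := h.m_eq
  have hVP := h.mem_vertexSet hP
  have hVQ : ∀ x y, (x, y) ∈ vertexSet Q ↔ ColVertex q p r y x ∨
      CornerOf (fun u v => (u, v) ∈ C) x y := fun x y => by
    rw [mem_vertexSet_of_cells hQ, ← cornerOf_colCell (by omega), ← cornerOf_swap (x := x)]
  have hVQ' : ∀ x y, (x, y) ∈ vertexSet Q → MeetsOnlyJunction q p s r n m y x ∨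
      ColVertex q p r y x := fun x y hxy =>
    ((hVQ x y).mp hxy).symm.imp_left fun g => meetsOnlyJunction_swap.mpr (h.meetsOnlyJunction g)
  obtain ⟨hface, heq⟩ := hilbertSeries_region_or (R' := InnerCol p q s m) hprime
    (h.isFace_outerCol hP) ({p + m} ×ˢ Finset.Icc (q + 2) (q + s - 1))
    (fun x y => by
      simp only [Finset.mem_product, Finset.mem_Icc, Finset.mem_singleton, InnerCol])
    (fun ⟨x, y⟩ hxy => by
      simp only [Finset.mem_product, Finset.mem_Icc, Finset.mem_singleton] at hxy
      exact (hVP x y).mpr (Or.inl (Or.inr (by omega))))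
    (fun x y => by
      unfold InnerCol OuterCol
      omega)
    (by
      rw [cells_eq hP]
      exact fun a₁ a₂ b₁ b₂ h1 h2 hc ha hb _ _ => h.not_innerCol h1 h2 hc ha hb)
  rw [heq, Finset.card_product, Int.card_Icc, Finset.card_singleton, one_mul,
    show q + s - 1 + 1 - (q + 2) = s - 2 by ring]
  congr 1
  refine hilbertSeries_region_eq_HP hface (fun t => (relabel q p m t.2 t.1, t.2)) ?_ ?_ ?_ ?_
  · rintro ⟨x, y⟩ ht
    rw [hVQ] at ht
    rw [hVP]
    rcases relabel_spec q p m y x with ⟨h1, h2, h3, h4⟩ | ⟨-, h4⟩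
    · left
      simp only [h4]
      exact Or.inr (by omega)
    · simp only [h4]
      refine ht.imp_left fun ht => Or.inl ?_
      unfold ColVertex at ht
      omega
  · rintro ⟨x, y⟩ ht ⟨x', y'⟩ ht' heq
    simp only [Prod.mk.injEq] at heq
    obtain ⟨heq, rfl⟩ := heq
    rw [h.swap.relabel_injective (hVQ' _ _ ht) (hVQ' _ _ ht') heq]
  · rintro ⟨x, y⟩ ht
    have key := h.swap.exists_relabel_iff (x := y) (y := x)
      (((hVP x y).mp ht).imp armVertex_swap.mpr cornerOf_swap.mpr)
    refine key.trans ?_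
    constructor
    · rintro ⟨x', h1, h2⟩
      exact ⟨(x', y), (hVQ _ _).mpr (h1.imp_right cornerOf_swap.mp), by simp [h2]⟩
    · rintro ⟨⟨x', y'⟩, h1, h2⟩
      simp only [Prod.mk.injEq] at h2
      obtain ⟨h2, rfl⟩ := h2
      exact ⟨x', ((hVQ _ _).mp h1).imp_right cornerOf_swap.mpr, h2⟩
  · rintro ⟨a₁, a₂⟩ ha ⟨b₁, b₂⟩ hb ⟨c₁, c₂⟩ hc ⟨d₁, d₂⟩ hd
    -- Transposition fixes the diagonal corners and exchanges the two anti-diagonal ones, so `c` and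
    -- `d` trade places.
    have k1 := h.swap.relabel_interval (hVQ' _ _ ha) (hVQ' _ _ hb) (c₁ := d₂) (c₂ := d₁)
      (hVQ' _ _ hc)
    have k2 := h.swap.interval_relabel (a₁ := a₂) (a₂ := a₁) (b₁ := b₂) (b₂ := b₁) (c₁ := d₂)
      (c₂ := d₁) (d₁ := c₂) (d₂ := c₁)
    have hP' : ∀ u v, (u, v) ∈ P ↔ ArmCell q p s r v u ∨ (u, v) ∈ C := fun u v => by
      rw [hP]
      exact or_congr_left or_comm
    rw [innerCorners_iff hP', innerCorners_iff hQ, ← cellsIn_swap,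
      ← cellsIn_swap (a₁ := a₁) (b₁ := b₁)]
    constructor
    · rintro ⟨g1, g2, g3, g4, g5, g6, g7⟩
      obtain ⟨f1, f2, f3, f4, f5, f6, f7⟩ := k1 ⟨g2, g1, g3, g7, g6, g5, g4⟩
      exact ⟨f2, f1, f3, f7, f6, f5, f4⟩
    · rintro ⟨g1, g2, g3, g4, g5, g6, g7⟩
      obtain ⟨f1, f2, f3, f4, f5, f6, f7⟩ := k2 ⟨g2, g1, g3, g7, g6, g5, g4⟩
      exact ⟨f2, f1, f3, f7, f6, f5, f4⟩

theorem Attached.hilbertSeries_outer (h : Attached p q r s m n fun u v => (u, v) ∈ C)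
    (hP : ∀ u v, (u, v) ∈ P ↔ ArmCell p q r s u v ∨ (u, v) ∈ C)
    (hprime : (binomialIdeal K (innerRel P) ∅).IsPrime) :
    hilbertSeries (binomialIdeal K (innerRel P)
      (region P (OuterRow p q r n) ∪ region P (OuterCol p q s m))) =
      ((1 - PowerSeries.X)⁻¹) ^ (r + s - 3).toNat * HP K C := by
  have hr := h.two_le_r
  have hs := h.two_le_s
  have hm := h.m_eq
  have hn := h.n_eq
  have hVP := h.mem_vertexSet hP
  have hVC := mem_vertexSet_iff C
  obtain ⟨hface, heq⟩ := hilbertSeries_region_or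
    (R := fun x y => OuterRow p q r n x y ∨ OuterCol p q s m x y)
    (R' := fun x y => InnerRow p q r n x y ∨ InnerCol p q s m x y ∨ (x = p + m ∧ y = q + n)) hprime
    ((h.isFace_outerRow hP).union (h.isFace_outerCol hP))
    (Finset.disjUnion (Finset.Icc (p + 2) (p + r - 1) ×ˢ {q + n})
      ({p + m} ×ˢ insert (q + n) (Finset.Icc (q + 2) (q + s - 1)))
      (by
        rw [Finset.disjoint_left]
        rintro ⟨x, y⟩ h1 h2
        simp only [Finset.mem_product, Finset.mem_Icc, Finset.mem_singleton] at h1 h2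
        omega))
    (fun x y => by
      simp only [Finset.mem_disjUnion, Finset.mem_product, Finset.mem_Icc, Finset.mem_singleton,
        Finset.mem_insert, InnerRow, InnerCol]
      omega)
    (fun ⟨x, y⟩ hxy => by
      simp only [Finset.mem_disjUnion, Finset.mem_product, Finset.mem_Icc, Finset.mem_singleton,
        Finset.mem_insert] at hxy
      refine (hVP x y).mpr (Or.inl ?_)
      unfold ArmVertex
      omega)
    (fun x y => by
      unfold InnerRow InnerCol OuterRow OuterCol
      omega)
    (by
      rw [cells_eq hP]
      intro a₁ a₂ b₁ b₂ h1 h2 hc ha hb _ _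
      push Not at ha hb
      obtain ⟨hcell, -⟩ := h.cellsIn_of_avoids h1 h2 hc ha.1 hb.1 ha.2 hb.2
      have key : ∀ x y, CornerOf (fun u v => (u, v) ∈ C) x y → ¬ (InnerRow p q r n x y ∨
          InnerCol p q s m x y ∨ (x = p + m ∧ y = q + n)) := fun x y hxy g =>
        (h.cornerOf_iff (Or.inr hxy)).mpr hxy (Or.inr g)
      have hin : IsInnerInterval C (a₁, a₂) (b₁, b₂) :=
        (isInnerInterval_iff _ _ _).mpr ⟨h1, h2, hcell⟩
      obtain ⟨g1, g2, g3, g4⟩ := hin.corners_mem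
      exact ⟨key _ _ ((hVC _ _).mp g1), key _ _ ((hVC _ _).mp g2), key _ _ ((hVC _ _).mp g3),
        key _ _ ((hVC _ _).mp g4)⟩)
  -- The extra `1` is the vertex `(p + m, q + n)`, the corner of `A` on neither outer side.
  have hcard : (r - 2).toNat + ((s - 2).toNat + 1) = (r + s - 3).toNat := by omega
  refine heq.trans ?_
  rw [Finset.card_disjUnion, Finset.card_product, Finset.card_product, Int.card_Icc,
    Finset.card_singleton, Finset.card_singleton, mul_one, one_mul,
    Finset.card_insert_of_notMem (by simp only [Finset.mem_Icc]; omega), Int.card_Icc,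
    show p + r - 1 + 1 - (p + 2) = r - 2 by ring, show q + s - 1 + 1 - (q + 2) = s - 2 by ring,
    hcard]
  congr 1
  refine hilbertSeries_region_eq_HP hface id ?_ ?_ ?_ ?_
  · rintro ⟨x, y⟩ ht
    exact (hVP x y).mpr (Or.inr ((hVC x y).mp ht))
  · exact fun _ _ _ _ h => h
  · rintro ⟨x, y⟩ ht
    rw [h.cornerOf_iff ((hVP x y).mp ht), ← hVC]
    simp
  · rintro ⟨a₁, a₂⟩ ha ⟨b₁, b₂⟩ hb ⟨c₁, c₂⟩ hc ⟨d₁, d₂⟩ hd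
    have hC : ∀ u v, (u, v) ∈ C ↔ (fun u v => (u, v) ∈ C) u v := fun _ _ => Iff.rfl
    simp only [id_eq]
    rw [innerCorners_iff hP, innerCorners_iff hC]
    have key : ∀ x y, (x, y) ∈ vertexSet C → ¬ OuterRow p q r n x y ∧ ¬ OuterCol p q s m x y :=
      fun x y hxy => by
        have hxy := (hVC x y).mp hxy
        have := (h.cornerOf_iff (Or.inr hxy)).mpr hxy
        tauto
    refine and_congr_right fun h1 => and_congr_right fun h2 => and_congr_left fun _ => ?_
    constructor
    · exact fun hc => (h.cellsIn_of_avoids h1 h2 hc (key _ _ ha).1 (key _ _ hb).1 (key _ _ ha).2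
        (key _ _ hb).2).1
    · exact fun hc u v k1 k2 k3 k4 => Or.inr (hc u v k1 k2 k3 k4)

theorem Attached.hilbertSeries_cornerCell (h : Attached p q r s m n fun u v => (u, v) ∈ C)
    (hP : ∀ u v, (u, v) ∈ P ↔ ArmCell p q r s u v ∨ (u, v) ∈ C)
    (hQ : ∀ u v, (u, v) ∈ Q ↔ (ArmCell p q r s u v ∨ (u, v) ∈ C) ∧ ¬ (u = p ∧ v = q) ∧
      ¬ (u = p + 1 ∧ v = q) ∧ ¬ (u = p ∧ v = q + 1)) :
    hilbertSeries (binomialIdeal K (innerRel P) (region P (CornerCell p q))) = HP K Q := by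
  have hVP := h.mem_vertexSet hP
  have hVQ : ∀ x y, (x, y) ∈ vertexSet Q ↔ (x, y) ∈ vertexSet P ∧ ¬ CornerCell p q x y :=
    fun x y => by
      rw [mem_vertexSet_iff, cells_eq hQ, hVP]
      exact h.cornerOf_sdiff_corner
  refine hilbertSeries_region_eq_HP (h.isFace_cornerCell hP) id ?_ ?_ ?_ ?_
  · rintro ⟨x, y⟩ ht
    exact ((hVQ x y).mp ht).1
  · exact fun _ _ _ _ h => h
  · rintro ⟨x, y⟩ ht
    have := hVQ x y
    simp only [id_eq, exists_eq_right]
    tauto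
  · rintro ⟨a₁, a₂⟩ ha ⟨b₁, b₂⟩ hb ⟨c₁, c₂⟩ hc ⟨d₁, d₂⟩ hd
    simp only [id_eq]
    rw [innerCorners_iff hP, innerCorners_iff hQ]
    refine and_congr_right fun h1 => and_congr_right fun h2 => and_congr_left fun _ => ?_
    exact ⟨fun hc => h.cellsIn_sdiff_corner h1 h2 hc ((hVQ _ _).mp ha).2,
      fun hc u v k1 k2 k3 k4 => (hc u v k1 k2 k3 k4).1⟩

end Regions

/-! ### The chain of colon ideals at the corner cell -/

section Main

variable {K : Type*} [Field K] {P Q C : Finset Cell} {p q r s m n : ℤ}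

/-- Add the corners of `A` in the order `v`, `y₁`, `y₂`, `y₃`, so that each product of the new
corner with a variable of the next face reduces to a corner already added. -/
theorem Attached.hilbertSeries_eq (h : Attached p q r s m n fun u v => (u, v) ∈ C)
    (hP : ∀ u v, (u, v) ∈ P ↔ ArmCell p q r s u v ∨ (u, v) ∈ C)
    (hprime : (binomialIdeal K (innerRel P) ∅).IsPrime) :
    hilbertSeries (binomialIdeal K (innerRel P) ∅) = (1 - PowerSeries.X)⁻¹ *
      (hilbertSeries (binomialIdeal K (innerRel P) (region P (CornerCell p q))) +
        PowerSeries.X * hilbertSeries (binomialIdeal K (innerRel P)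
          (region P (OuterRow p q r n) ∪ region P (OuterCol p q s m))) +
        PowerSeries.X * hilbertSeries (binomialIdeal K (innerRel P)
          (region P (OuterCol p q s m))) +
        PowerSeries.X * hilbertSeries (binomialIdeal K (innerRel P)
          (region P (OuterRow p q r n)))) := by
  have hr := h.two_le_r
  have hs := h.two_le_s
  have hm := h.m_eq
  have hn := h.n_eq
  have hV : ∀ x y, CornerCell p q x y → (x, y) ∈ vertexSet P := fun x y hxy =>
    (h.mem_vertexSet hP x y).mpr (Or.inl (by unfold CornerCell at hxy; unfold ArmVertex; omega))
  have hG := isSquarefree_innerRel P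
  let v : vertexSet P := ⟨(p + 1 - m, q + 1 - n), hV _ _ (by unfold CornerCell; omega)⟩
  let y₁ : vertexSet P := ⟨(p + 1 - m, q + n), hV _ _ (by unfold CornerCell; omega)⟩
  let y₂ : vertexSet P := ⟨(p + m, q + 1 - n), hV _ _ (by unfold CornerCell; omega)⟩
  let y₃ : vertexSet P := ⟨(p + m, q + n), hV _ _ (by unfold CornerCell; omega)⟩
  have hv1 : v ∈ region P (OuterRow p q r n) := by
    change OuterRow p q r n (p + 1 - m) (q + 1 - n)
    unfold OuterRow
    omega
  have hv2 : v ∈ region P (OuterCol p q s m) := by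
    change OuterCol p q s m (p + 1 - m) (q + 1 - n)
    unfold OuterCol
    omega
  have h12 : y₁ ∈ region P (OuterCol p q s m) := by
    change OuterCol p q s m (p + 1 - m) (q + n)
    unfold OuterCol
    omega
  have h21 : y₂ ∈ region P (OuterRow p q r n) := by
    change OuterRow p q r n (p + m) (q + 1 - n)
    unfold OuterRow
    omega
  have h11 : y₁ ∉ region P (OuterRow p q r n) := by
    change ¬ OuterRow p q r n (p + 1 - m) (q + n)
    unfold OuterRow
    omega
  have h22 : y₂ ∉ region P (OuterCol p q s m) := by
    change ¬ OuterCol p q s m (p + m) (q + 1 - n)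
    unfold OuterCol
    omega
  have h3 : y₃ ∉ region P (OuterRow p q r n) ∪ region P (OuterCol p q s m) := by
    simp only [Set.mem_union, mem_region, OuterRow, OuterCol, y₃]
    omega
  have hcorner : insert y₃ (insert y₂ (insert y₁ {v})) = region P (CornerCell p q) := by
    ext ⟨⟨x, y⟩, hz⟩
    simp only [Set.mem_insert_iff, Set.mem_singleton_iff, mem_region, CornerCell, v, y₁, y₂, y₃,
      Subtype.mk.injEq, Prod.mk.injEq]
    omega
  -- The empty set is a face, and the colon of the prime `I_P` by `v` is `I_P` itself.
  have e0 := IsFace.hilbertSeries_insert (Z := ∅) hG hprime (y := v)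
    (fun a b c d _ => by simp) (Set.notMem_empty v)
  rw [insert_empty_eq] at e0
  -- For `z` on the outer row, the minor with opposite corners `y₁, z` has `v` in its other
  -- monomial.
  have e1 := hilbertSeries_binomialIdeal_insert (Y := {v}) hG hprime (h.isFace_outerRow hP)
    (Set.singleton_subset_iff.mpr hv1) h11 (fun z hz => by
      obtain ⟨hz, hz1, hz2⟩ := hz
      exact X_mul_X_mem_row hP hn (i := p + 1 - m) (j := z.1.1) (by omega) (by omega) hz1 hz2
        (c := v) rfl (Prod.ext rfl hz) rfl rfl)
  -- The face is now the outer column, which already contains `v` and `y₁`; the minors with opposite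
  -- corners `y₂, z` again involve `v`.
  have e2 := hilbertSeries_binomialIdeal_insert (Y := insert y₁ {v}) hG hprime
    (h.isFace_outerCol hP)
    (Set.insert_subset h12 (Set.singleton_subset_iff.mpr hv2)) h22 (fun z hz => by
      obtain ⟨hz, hz1, hz2⟩ := hz
      exact X_mul_X_mem_col hP hm (i := q + 1 - n) (j := z.1.2) (by omega) (by omega) hz1 hz2
        (c := v) rfl (Prod.ext hz rfl) rfl (Or.inr rfl))
  -- For `y₃` the product with an outer row vertex reduces through `y₂`, and with an outer column
  -- vertex through `y₁`, so both sides enter the colon ideal.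
  have e3 := hilbertSeries_binomialIdeal_insert (Y := insert y₂ (insert y₁ {v})) hG hprime
    ((h.isFace_outerRow hP).union (h.isFace_outerCol hP))
    (Set.insert_subset (Or.inl h21) (Set.insert_subset (Or.inr h12)
      (Set.singleton_subset_iff.mpr (Or.inl hv1)))) h3 (fun z hz => by
      rcases hz with ⟨hz, hz1, hz2⟩ | ⟨hz, hz1, hz2⟩
      · exact X_mul_X_mem_row hP hn (i := p + m) (j := z.1.1) (by omega) (by omega) hz1 hz2
          (c := y₂) rfl (Prod.ext rfl hz) rfl (Or.inl rfl)
      · exact X_mul_X_mem_col hP hm (i := q + n) (j := z.1.2) (by omega) (by omega) hz1 hz2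
          (c := y₁) rfl (Prod.ext hz rfl) rfl (Or.inr (Or.inl rfl)))
  rw [hcorner] at e3
  rw [e0, e1, e2, e3]

theorem mem_lShape (p q : ℤ) (r s : ℕ) (u v : ℤ) :
    (u, v) ∈ lShape (p, q) r s ↔ ArmCell p q r s u v := by
  simp only [lShape, cellInterval, rightCell, upCell, Finset.mem_union, Finset.mem_Icc,
    Prod.mk_add_mk, Prod.mk_le_mk, add_zero, ArmCell]
  omega

/-- The sides of the arms on which the junction vertices of each type lie. -/
theorem mem_junction (p q : ℤ) {r s : ℕ} (hr : 2 ≤ r) (hs : 2 ≤ s) (i : Fin 4) :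
    ∃ m n : ℤ, (m = 0 ∨ m = 1) ∧ (n = 0 ∨ n = 1) ∧ ∀ x y,
      (x, y) ∈ junction (p, q) r s i ↔ JunctionVertex p q r s m n x y := by
  fin_cases i
  · refine ⟨1, 1, by simp, by simp, fun x y => ?_⟩
    simp [junction, JunctionVertex, upperRight, upCell, rightCell]
    omega
  · refine ⟨1, 0, by simp, by simp, fun x y => ?_⟩
    simp [junction, JunctionVertex, upperRight, lowerRight, upCell, rightCell]
    omega
  · refine ⟨0, 1, by simp, by simp, fun x y => ?_⟩
    simp [junction, JunctionVertex, upperRight, upperLeft, upCell, rightCell]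
    omega
  · refine ⟨0, 0, by simp, by simp, fun x y => ?_⟩
    simp [junction, JunctionVertex, upperLeft, lowerRight, upCell, rightCell]
    omega

theorem IsLCPolyomino.exists_attached {p q : ℤ} {r s : ℕ} {C P : Finset Cell}
    (h : IsLCPolyomino (p, q) r s C P) :
    ∃ m n : ℤ, Attached p q r s m n fun u v => (u, v) ∈ C := by
  obtain ⟨i, hi, -⟩ := h.junction_eq
  obtain ⟨m, n, hm, hn, hj⟩ := mem_junction p q h.two_le_r h.two_le_s i
  refine ⟨m, n, by exact_mod_cast h.two_le_r, by exact_mod_cast h.two_le_s, hm, hn,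
    fun x y hxy => ?_⟩
  have hL : (x, y) ∈ vertexSet (lShape (p, q) r s) := by
    rw [mem_vertexSet_iff, cells_eq (mem_lShape p q r s), cornerOf_armCell (by simp) (by simp)]
    exact hxy
  rw [← hj, ← hi, Finset.mem_inter, ← mem_vertexSet_iff]
  simp [hL]

end Main

end Polyomino

theorem mainTheorem4 {K : Type*} [Field K] (A : Polyomino.Cell) (r s : ℕ)
    (C P : Finset Polyomino.Cell) (hP : Polyomino.IsLCPolyomino A r s C P)
    (hprime : (Polyomino.polyominoIdeal K P).IsPrime) :
    Polyomino.HP K P =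
      (1 - PowerSeries.X)⁻¹ * Polyomino.HP K (Polyomino.P₄ A P) +
        PowerSeries.X * (1 - PowerSeries.X)⁻¹ *
          (((1 - PowerSeries.X)⁻¹) ^ (r - 2) * Polyomino.HP K (Polyomino.P₁ A r P) +
            ((1 - PowerSeries.X)⁻¹) ^ (s - 2) * Polyomino.HP K (Polyomino.P₂ A s P) +
            ((1 - PowerSeries.X)⁻¹) ^ (r + s - 3) * Polyomino.HP K (Polyomino.P₃ A r s P)) := by
  obtain ⟨p, q⟩ := A
  obtain ⟨m, n, h⟩ := hP.exists_attached
  have hr := hP.two_le_r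
  have hs := hP.two_le_s
  have hmem : ∀ u v, (u, v) ∈ P ↔ Polyomino.ArmCell p q r s u v ∨ (u, v) ∈ C := fun u v => by
    rw [hP.eq_union, Finset.mem_union, Polyomino.mem_lShape]
  have hnot := fun u v => h.not_armCell (u := u) (v := v)
  have h₁ : ∀ u v, (u, v) ∈ Polyomino.P₁ (p, q) r P ↔
      Polyomino.ColCell p q s u v ∨ (u, v) ∈ C := fun u v => by
    have hnot := hnot u v
    simp only [Polyomino.P₁, Polyomino.cellInterval, Polyomino.rightCell, Finset.mem_sdiff, hmem,
      Finset.mem_Icc, Prod.mk_add_mk, Prod.mk_le_mk, add_zero]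
    unfold Polyomino.ArmCell at *
    unfold Polyomino.ColCell
    by_cases huv : (u, v) ∈ C
    · have := hnot huv
      simp only [huv, or_true, true_and, iff_true]
      omega
    · simp only [huv, or_false]
      omega
  have h₂ : ∀ u v, (u, v) ∈ Polyomino.P₂ (p, q) s P ↔
      Polyomino.ColCell q p r v u ∨ (u, v) ∈ C := fun u v => by
    have hnot := hnot u v
    simp only [Polyomino.P₂, Polyomino.cellInterval, Polyomino.upCell, Finset.mem_sdiff, hmem,
      Finset.mem_Icc, Prod.mk_add_mk, Prod.mk_le_mk, add_zero]
    unfold Polyomino.ArmCell at *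
    unfold Polyomino.ColCell
    by_cases huv : (u, v) ∈ C
    · have := hnot huv
      simp only [huv, or_true, true_and, iff_true]
      omega
    · simp only [huv, or_false]
      omega
  have h₃ : Polyomino.P₃ (p, q) r s P = C := by
    rw [Polyomino.P₃, hP.eq_union]
    exact Finset.union_sdiff_cancel_left hP.disjoint
  have h₄ : ∀ u v, (u, v) ∈ Polyomino.P₄ (p, q) P ↔
      (Polyomino.ArmCell p q r s u v ∨ (u, v) ∈ C) ∧ ¬ (u = p ∧ v = q) ∧
      ¬ (u = p + 1 ∧ v = q) ∧ ¬ (u = p ∧ v = q + 1) := fun u v => by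
    simp only [Polyomino.P₄, Polyomino.rightCell, Polyomino.upCell, Finset.mem_sdiff, hmem,
      Finset.mem_insert, Finset.mem_singleton, Prod.mk_add_mk, Prod.mk.injEq, add_zero,
      Nat.cast_one, not_or]
  rw [Polyomino.polyominoIdeal_eq] at hprime
  have key := h.hilbertSeries_eq hmem hprime
  rw [h.hilbertSeries_cornerCell hmem h₄, h.hilbertSeries_outer hmem hprime,
    h.hilbertSeries_outerCol hmem h₂ hprime, h.hilbertSeries_outerRow hmem h₁ hprime,
    ← Polyomino.HP_eq, show ((r : ℤ) - 2).toNat = r - 2 by omega,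
    show ((s : ℤ) - 2).toNat = s - 2 by omega,
    show ((r : ℤ) + s - 3).toNat = r + s - 3 by omega] at key
  rw [key, h₃]
  ring
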